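/- **Setting.** Let $X$ be a locally compact, separable, metrizable space, $m$ a positive Radon measure on $X$ with full support, and $(\mathcal E,\mathcal F)$ a (symmetric) regular Dirichlet form on $L^2(X;m)$ that is strong local: $\mathcal E(f,g)=0$ for $f,g\in\mathcal F$ whenever the supports of $|f|\cdot m$ and $|g|\cdot m$ are compact and $g$ is constant on a neighbourhood of the support of $|f|\cdot m$. Equip $\mathcal F$ with the norm whose square is $\mathcal E(f,f)+\|f\|_{L^2(m)}^2$. For bounded $f\in\mathcal F$, the energy measure $\mu_{\langle f\rangle}$ is the finite Borel measure with $\int\varphi\,d\mu_{\langle f\rangle}=2\mathcal E(f\varphi,f)-\mathcal E(\varphi,f^2)$ for all $\varphi\in\mathcal F\cap C_c(X)$. For general $f\in\mathcal F$, it is the setwise limit of the energy measures of bounded functions converging to $f$ in $\mathcal F$. Put $\mu_{\langle f,g\rangle}=\frac12(\mu_{\langle f+g\rangle}-\mu_{\langle f\rangle}-\mu_{\langle g\rangle})$. Let $\nu$ be a minimal energy-dominant measure, i.e. a $\sigma$-finite Borel measure with $\mu_{\langle f\rangle}\ll\nu$ for all $f\in\mathcal F$ and with $\nu\ll\nu'$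 for every $\sigma$-finite Borel measure $\nu'$ having the same property. Let $p(\cdot)$ be the pointwise index, i.e. the $\nu$-a.e. smallest $\nu$-measurable function $X\to\{0,1,2,\dots\}\cup\{+\infty\}$ such that, for all $N$ and $f_1,\dots,f_N\in\mathcal F$, $$\operatorname{rank}\Big(\tfrac{d\mu_{\langle f_i,f_j\rangle}}{d\nu}(x)\Big)_{i,j=1}^N\le p(x)\quad\text{for $\nu$-a.e. }x.$$ Assume that the index $p=\nu\text{-}\operatorname{ess\,sup}_x p(x)$ is finite and positive. Fix ${\boldsymbol g}=(g_1,\dots,g_p)\in\mathcal F^p$ such that, for $\nu$-a.e. $x$, the matrix $\big(\frac{d\mu_{\langle g_i,g_j\rangle}}{d\nu}(x)\big)_{i,j=1}^{p(x)}$ is invertible. Write $Z_{\boldsymbol g}=\big(\frac{d\mu_{\langle g_i,g_j\rangle}}{d\nu}\big)_{i,j=1}^{p}$, and write $\tilde f$ for a quasi-continuous modification of $f$. A function $R$ belongs to $\dot{\mathcal F}_{\mathrm{loc}}$ (locally in $\mathcal F$ in the broad sense) if it is $m$-measurable and there are an increasing sequence of Borel quasi-open sets $G_k$, with $X\setminus\bigcup_kG_k$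 of zero capacity, and $u_k\in\mathcal F$ with $R=u_k$ $m$-a.e. on $G_k$. Its energy measure $\mu_{\langle R\rangle}$ coincides with $\mu_{\langle u_k\rangle}$ on $G_k$ and does not charge $X\setminus\bigcup_kG_k$. **Theorem (analogue of differentials of functions in $\mathcal F$).** For every $f\in\mathcal F$ there exists a $\nu$-measurable $\mathbb R^p$-valued function $\nabla_{\boldsymbol g}f=(\partial^{(1)}f,\dots,\partial^{(p)}f)$ on $X$ such that: 1. For $\nu$-a.e. $x$, $\partial^{(i)}f(x)=0$ for all $i>p(x)$. 2. For any quasi-continuous modifications $\tilde f,\tilde g_1,\dots,\tilde g_p$, defining $R_x$ for $x\in X$ by $$\tilde f(y)-\tilde f(x)=\sum_{i\le p(x)}\partial^{(i)}f(x)\big(\tilde g_i(y)-\tilde g_i(x)\big)+R_x(y),\qquad y\in X,$$ (the sum being over $1\le i\le p$ with $i\le p(x)$), one has $R_x\in\dot{\mathcal F}_{\mathrm{loc}}$, and $\mu_{\langle R_x\rangle}$ has the $\nu$-density $$\frac{d\mu_{\langle R_x\rangle}}{d\nu}(y)=\frac{d\mu_{\langle f\rangle}}{d\nu}(y)-2\sum_{i\le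 p(x)}\partial^{(i)}f(x)\frac{d\mu_{\langle f,g_i\rangle}}{d\nu}(y)+\sum_{i,j\le p(x)}\partial^{(i)}f(x)\,\partial^{(j)}f(x)\frac{d\mu_{\langle g_i,g_j\rangle}}{d\nu}(y),$$ where versions of the densities on the right are fixed once and for all. 3. $R_x$ is negligible at $x$: the expression for $\frac{d\mu_{\langle R_x\rangle}}{d\nu}(y)$ in 2 vanishes at $y=x$ for $\nu$-a.e. $x$. The function $\nabla_{\boldsymbol g}f$ with these properties is unique up to $\nu$-equivalence. Moreover, for all $f,h\in\mathcal F$, the function $(Z_{\boldsymbol g}\nabla_{\boldsymbol g}f,\nabla_{\boldsymbol g}h)_{\mathbb R^p}$ is $\nu$-integrable and $$\mathcal E(f,h)=\frac12\int_X\big(Z_{\boldsymbol g}\nabla_{\boldsymbol g}f,\nabla_{\boldsymbol g}h\big)_{\mathbb R^p}\,d\nu .$$ -/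

import Mathlib

open MeasureTheory Filter Topology
open scoped ENNReal CompactlySupported

/-- A (symmetric) Dirichlet form on `L²(X; m)`: a densely defined, nonnegative definite symmetric
bilinear form which is closed (its domain is complete for `E(u,u) + ‖u‖²`) and Markovian (the unit
contraction operates). -/
structure DirichletForm {X : Type*} [MeasurableSpace X] (m : Measure X) where
  domain : Submodule ℝ (Lp ℝ 2 m)
  form : domain →ₗ[ℝ] domain →ₗ[ℝ] ℝ
  dense_domain : Dense (domain : Set (Lp ℝ 2 m))
  symm : ∀ u v : domain, form u v = form v u
  nonneg : ∀ u : domain, 0 ≤ form u u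
  closed : ∀ u : ℕ → domain,
    (∀ ε > 0, ∃ N, ∀ j ≥ N, ∀ k ≥ N,
      form (u j - u k) (u j - u k) + ‖(u j - u k : Lp ℝ 2 m)‖ ^ 2 < ε) →
    ∃ f : domain, Tendsto
      (fun k => form (u k - f) (u k - f) + ‖(u k - f : Lp ℝ 2 m)‖ ^ 2) atTop (𝓝 0)
  markov : ∀ u : domain, ∃ v : domain,
    (v.1 =ᵐ[m] fun x => min (max (u.1 x) 0) 1) ∧ form v v ≤ form u u

namespace DirichletForm

section Basic

variable {X : Type*} [TopologicalSpace X] [MeasurableSpace X] {m : Measure X}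
  (E : DirichletForm m)

/-- The squared norm `E(u,u) + ∫ u² dm` of the Hilbert space `F`. -/
noncomputable def normSq (u : E.domain) : ℝ := E.form u u + ‖(u : Lp ℝ 2 m)‖ ^ 2

/-- Regularity: `F ∩ C_c(X)` is dense in `F` and, for the uniform norm, in `C_c(X)`. -/
structure IsRegular : Prop where
  dense_in_domain : ∀ f : E.domain, ∀ ε > 0, ∃ (φ : C_c(X, ℝ)) (u : E.domain),
    u.1 =ᵐ[m] φ ∧ E.normSq (f - u) < ε
  dense_in_continuous : ∀ ψ : C_c(X, ℝ), ∀ ε > 0, ∃ (φ : C_c(X, ℝ)) (u : E.domain),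
    u.1 =ᵐ[m] φ ∧ ∀ x, |ψ x - φ x| < ε

/-- `supp[f]`, the support of the measure `|f| · m`. -/
noncomputable def supp (f : E.domain) : Set X := (m.withDensity fun x => ‖f.1 x‖ₑ).support

/-- Strong locality. -/
def IsStronglyLocal : Prop :=
  ∀ f g : E.domain, IsCompact (E.supp f) → IsCompact (E.supp g) →
    (∃ (U : Set X) (c : ℝ), IsOpen U ∧ E.supp f ⊆ U ∧ ∀ᵐ x ∂m, x ∈ U → g.1 x = c) →
    E.form f g = 0

/-- The `1`-capacity: for open `U`, the infimum of `E(u,u) + ‖u‖²` over `u ∈ F` with `u ≥ 1` a.e.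
on `U`; for general `A`, the infimum of this over the open sets `U` containing `A`. -/
noncomputable def cap (A : Set X) : ℝ≥0∞ :=
  ⨅ (U : Set X) (_ : IsOpen U) (_ : A ⊆ U) (u : E.domain) (_ : ∀ᵐ x ∂m, x ∈ U → 1 ≤ u.1 x),
    ENNReal.ofReal (E.normSq u)

/-- `ft` is a quasi-continuous modification of `f`. -/
def IsQuasiContinuousModification (f : E.domain) (ft : X → ℝ) : Prop :=
  f.1 =ᵐ[m] ft ∧ ∀ ε > 0, ∃ U : Set X, IsOpen U ∧ E.cap U < ε ∧ ContinuousOn ft Uᶜ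

/-- Quasi-open sets. -/
def IsQuasiOpen (A : Set X) : Prop := ∀ ε > 0, ∃ U : Set X, IsOpen U ∧ A ⊆ U ∧ E.cap (U \ A) < ε

/-- Defining relation of the energy measure of a bounded `f ∈ F`:
`∫ φ dμ = 2 E(f φ, f) - E(φ, f²)` for all `φ ∈ F ∩ C_c(X)`.
(For bounded `f` the products `f φ` and `f²` belong to `F`.) -/
def IsBoundedEnergyMeasure (f : E.domain) (μ : FiniteMeasure X) : Prop :=
  (∃ C : ℝ, ∀ᵐ x ∂m, |f.1 x| ≤ C) ∧
  ∀ (φ : C_c(X, ℝ)) (u : E.domain), u.1 =ᵐ[m] φ →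
    ∃ v w : E.domain, (v.1 =ᵐ[m] fun x => f.1 x * φ x) ∧ (w.1 =ᵐ[m] fun x => f.1 x ^ 2) ∧
      ∫ x, φ x ∂(μ : Measure X) = 2 * E.form v f - E.form u w

/-- `μ` is the energy measure of `f ∈ F`: the setwise limit on Borel sets of the energy measures of
bounded functions converging to `f` in `F`. -/
def IsEnergyMeasure (f : E.domain) (μ : FiniteMeasure X) : Prop :=
  ∃ (u : ℕ → E.domain) (μs : ℕ → FiniteMeasure X),
    (∀ k, E.IsBoundedEnergyMeasure (u k) (μs k)) ∧
    Tendsto (fun k => E.normSq (u k - f)) atTop (𝓝 0) ∧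
    ∀ B : Set X, MeasurableSet B →
      Tendsto (fun k => (μs k : Measure X) B) atTop (𝓝 ((μ : Measure X) B))

open Classical in
/-- The energy measure `μ_⟨f⟩` of `f ∈ F` (it exists and is unique for regular forms). -/
noncomputable def energyMeasure (f : E.domain) : FiniteMeasure X :=
  if h : ∃ μ, E.IsEnergyMeasure f μ then h.choose else 0

/-- The mutual energy measure `μ_⟨f,g⟩`. -/
noncomputable def mutualEnergyMeasure (f g : E.domain) : SignedMeasure X :=
  (1 / 2 : ℝ) • ((E.energyMeasure (f + g) : Measure X).toSignedMeasure
    - (E.energyMeasure f : Measure X).toSignedMeasure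
    - (E.energyMeasure g : Measure X).toSignedMeasure)

/-- `(G, u)` exhibits the function `f` on `X` as an element of `F` locally in the broad sense. -/
structure IsLocalization (f : X → ℝ) (G : ℕ → Set X) (u : ℕ → E.domain) : Prop where
  measurableSet : ∀ k, MeasurableSet (G k)
  quasiOpen : ∀ k, E.IsQuasiOpen (G k)
  mono : ∀ k, G k ⊆ G (k + 1)
  exhausts : E.cap (⋃ k, G k)ᶜ = 0
  eq_on : ∀ k, ∀ᵐ x ∂m, x ∈ G k → f x = (u k).1 x

/-- `f` is locally in `F` in the broad sense. -/
def MemLoc (f : X → ℝ) : Prop := AEMeasurable f m ∧ ∃ G u, E.IsLocalization f G u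

/-- `μ` is the energy measure of the function `f`, locally in `F` in the broad sense: it agrees with
`μ_⟨u k⟩` on `G k` (and, like all energy measures, does not charge the remaining set of capacity
zero). -/
def IsLocalEnergyMeasure (f : X → ℝ) (μ : Measure X) : Prop :=
  ∃ G u, E.IsLocalization f G u ∧
    (∀ k, μ.restrict (G k) = (E.energyMeasure (u k) : Measure X).restrict (G k)) ∧
    μ (⋃ k, G k)ᶜ = 0

/-- Minimal energy-dominant measures. -/
structure IsMinimalEnergyDominant (ν : Measure X) : Prop where
  sigmaFinite : SigmaFinite ν
  dominates : ∀ f, (E.energyMeasure f : Measure X) ≪ ν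
  minimal : ∀ ν' : Measure X, SigmaFinite ν' →
    (∀ f, (E.energyMeasure f : Measure X) ≪ ν') → ν ≪ ν'

/-- A version of `dμ_⟨f,g⟩ / dν`. -/
noncomputable def density (ν : Measure X) (f g : E.domain) : X → ℝ :=
  (E.mutualEnergyMeasure f g).rnDeriv ν

/-- The matrix `(dμ_⟨f i, f j⟩ / dν (x))`. -/
noncomputable def gram {ι : Type*} (ν : Measure X) (f : ι → E.domain) (x : X) : Matrix ι ι ℝ :=
  Matrix.of fun i j => E.density ν (f i) (f j) x

/-- `p` bounds the rank of all matrices of densities. -/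
def BoundsRank (ν : Measure X) (p : X → ℕ∞) : Prop :=
  ∀ (N : ℕ) (f : Fin N → E.domain), ∀ᵐ x ∂ν, ((E.gram ν f x).rank : ℕ∞) ≤ p x

/-- `p` is (a version of) the pointwise index. -/
structure IsPointwiseIndex (ν : Measure X) (p : X → ℕ∞) : Prop where
  aemeasurable : AEMeasurable p ν
  boundsRank : E.BoundsRank ν p
  minimal : ∀ p' : X → ℕ∞, AEMeasurable p' ν → E.BoundsRank ν p' → p ≤ᵐ[ν] p'

/-- The set `𝒢` of coordinate systems: for a.e. `x`, the matrix `(dμ_⟨g i, g j⟩ / dν (x))`, where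
`i, j` range over the first `p x` indices, is invertible. -/
def IsCoordinateSystem (ν : Measure X) (p : X → ℕ∞) {n : ℕ} (g : Fin n → E.domain) : Prop :=
  ∀ᵐ x ∂ν, ∃ (r : ℕ) (hr : r ≤ n), p x = r ∧
    IsUnit (E.gram ν (fun i : Fin r => g (Fin.castLE hr i)) x)

/-- The first `k` indices of `Fin n` (all of them when `k ≥ n`). -/
def firstIndices (n : ℕ) (k : ℕ∞) : Finset (Fin n) :=
  Finset.univ.filter fun i : Fin n => ((i : ℕ) : ℕ∞) < k

/-- The natural version of the density, at `y`, of the energy measure of the remainder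
`R_x = f - ∑_{i ≤ p(x)} d_i(x) g_i + const`. -/
noncomputable def remainderDensity (ν : Measure X) (p : X → ℕ∞) {n : ℕ} (g : Fin n → E.domain)
    (f : E.domain) (d : X → Fin n → ℝ) (x y : X) : ℝ :=
  E.density ν f f y
    - 2 * ∑ i ∈ firstIndices n (p x), d x i * E.density ν f (g i) y
    + ∑ i ∈ firstIndices n (p x), ∑ j ∈ firstIndices n (p x),
        d x i * d x j * E.density ν (g i) (g j) y

/-- `d` is a gradient of `f` with respect to `g`. Coordinates are numbered from `0`, so `p x ≤ i`
means that `i` is not among the first `p x` of them. -/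
structure IsGradient (ν : Measure X) (p : X → ℕ∞) {n : ℕ} (g : Fin n → E.domain)
    (f : E.domain) (d : X → Fin n → ℝ) : Prop where
  aemeasurable : AEMeasurable d ν
  eq_zero : ∀ᵐ x ∂ν, ∀ i : Fin n, p x ≤ ((i : ℕ) : ℕ∞) → d x i = 0
  expansion : ∀ (ft : X → ℝ) (gt : Fin n → X → ℝ), E.IsQuasiContinuousModification f ft →
    (∀ i, E.IsQuasiContinuousModification (g i) (gt i)) →
    ∃ R : X → X → ℝ,
      (∀ x y, ft y - ft x =
        ∑ i ∈ firstIndices n (p x), d x i * (gt i y - gt i x) + R x y) ∧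
      ∀ x, E.MemLoc (R x) ∧ E.IsLocalEnergyMeasure (R x)
        (ν.withDensity fun y => ENNReal.ofReal (E.remainderDensity ν p g f d x y))
  negligible : ∀ᵐ x ∂ν, E.remainderDensity ν p g f d x x = 0

end Basic

end DirichletForm

/-! For fixed `x`, the function `R_x` is `f - ∑ d_i(x) g_i` plus a constant. Constants carry no
energy by strong locality, so the density of its energy measure at `y` is the quadratic form of the
Gram matrix of `(f, g)` at `y`, evaluated at the vector `(1, -d(x))`. This holds for any coefficient
field `d`. What singles out the gradient is vanishing on the diagonal `y = x`: the vector is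
isotropic for a positive semidefinite matrix, hence a null vector of it.

With `r = p(x)`, the Gram matrix of `f, g_1, ..., g_r` has rank at most `r` by the definition of the
index, while its `g`-corner is invertible. So it is singular, and a kernel vector can be normalized
to first entry `1` (`Matrix.eq_zero_of_bordered_rank_le`); this gives existence. The rows of the
null-vector equation are the normal equations `Z d = (dμ_⟨g_i,f⟩/dν)`, which give uniqueness.
Bordering by a second function `h` gives `dμ_⟨f,h⟩/dν = (Z ∇f, ∇h)`, and integration yields the
energy formula because the total mass of `μ_⟨f⟩` is `2 E(f,f)`.

All of this needs the energy measures to exist and to depend quadratically on `f`, and both are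
derived from the axioms of a Dirichlet form. Minimizing `E(v,v) + β‖v - f‖²` produces the
resolvents, which are symmetric Markovian contractions `S` of `L²`. For such `S` the squared
gradient `S(u²) - 2u S(u) + u²` is nonnegative and contracts under Lipschitz maps
(`carre_lipschitz`). In the limit `β → ∞`, bounded elements form an algebra and `φ ↦ 2E(uφ,u) -
E(φ,u²)` is positive with norm at most `2E(u,u)`. The Riesz theorem represents it by a measure.
Cauchy–Schwarz on each Borel set, with bounds that do not depend on the set, extends the measures to
all of the domain (`exists_setwise_limit`, `tendsto_bddEnergyReal`). Strong locality enters through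
the total mass and through vanishing where a function is constant. -/

namespace DirichletForm

/-! ### The resolvent by minimization, and the approximating forms. -/

section Resolvent

variable {X : Type*} [MeasurableSpace X] {m : Measure X}
  (E : DirichletForm m)

lemma form_add_self (u v : E.domain) :
    E.form (u + v) (u + v) = E.form u u + 2 * E.form u v + E.form v v := by
  simp only [map_add, LinearMap.add_apply]; rw [E.symm v u]; ring

lemma form_sub_self (u v : E.domain) :
    E.form (u - v) (u - v) = E.form u u - 2 * E.form u v + E.form v v := by
  simp only [map_sub, LinearMap.sub_apply]; rw [E.symm v u]; ring

lemma form_smul_self (c : ℝ) (u : E.domain) :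
    E.form (c • u) (c • u) = c ^ 2 * E.form u u := by
  simp only [map_smul, LinearMap.smul_apply, smul_eq_mul]; ring

lemma form_mul_form_le (u v : E.domain) : E.form u v ^ 2 ≤ E.form u u * E.form v v := by
  have h := LinearMap.BilinForm.apply_mul_apply_le_of_forall_zero_le E.form E.nonneg u v
  rw [E.symm v u] at h
  nlinarith [h]

lemma normSq_nonneg (u : E.domain) : 0 ≤ E.normSq u :=
  add_nonneg (E.nonneg u) (sq_nonneg _)

lemma form_add_self_le (u v : E.domain) :
    E.form (u + v) (u + v) ≤ 2 * E.form u u + 2 * E.form v v := by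
  have := E.nonneg (u - v)
  rw [form_sub_self] at this
  rw [form_add_self]; linarith

lemma tendsto_normSq_add {u v : ℕ → E.domain} {f g : E.domain}
    (hu : Tendsto (fun k => E.normSq (u k - f)) atTop (𝓝 0))
    (hv : Tendsto (fun k => E.normSq (v k - g)) atTop (𝓝 0)) :
    Tendsto (fun k => E.normSq (u k + v k - (f + g))) atTop (𝓝 0) := by
  have h := (hu.const_mul 2).add (hv.const_mul 2)
  rw [mul_zero, add_zero] at h
  refine squeeze_zero (fun k => E.normSq_nonneg _) (fun k => ?_) h
  rw [show u k + v k - (f + g) = (u k - f) + (v k - g) by abel]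
  have h1 := E.form_add_self_le (u k - f) (v k - g)
  have h2 := parallelogram_law_with_norm ℝ ((u k - f : E.domain) : Lp ℝ 2 m)
    ((v k - g : E.domain) : Lp ℝ 2 m)
  have h3 := mul_self_nonneg ‖((u k - f : E.domain) : Lp ℝ 2 m) - ((v k - g : E.domain) : Lp ℝ 2 m)‖
  simp only [normSq]
  rw [Submodule.coe_add (u k - f) (v k - g)]
  nlinarith

lemma tendsto_normSq_smul {u : ℕ → E.domain} {f : E.domain} (c : ℝ)
    (hu : Tendsto (fun k => E.normSq (u k - f)) atTop (𝓝 0)) :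
    Tendsto (fun k => E.normSq (c • u k - c • f)) atTop (𝓝 0) := by
  have h := hu.const_mul (c ^ 2)
  rw [mul_zero] at h
  refine h.congr fun k => ?_
  rw [← smul_sub]
  simp only [normSq, form_smul_self, Submodule.coe_smul, norm_smul, mul_pow, Real.norm_eq_abs,
    sq_abs]
  ring

/-- The functional whose minimizer is the resolvent. -/
noncomputable def penalized (β : ℝ) (f : Lp ℝ 2 m) (v : E.domain) : ℝ :=
  E.form v v + β * ‖(v : Lp ℝ 2 m) - f‖ ^ 2

lemma penalized_nonneg {β : ℝ} (hβ : 0 ≤ β) (f : Lp ℝ 2 m) (v : E.domain) :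
    0 ≤ E.penalized β f v :=
  add_nonneg (E.nonneg v) (mul_nonneg hβ (sq_nonneg _))

/-- The parallelogram law in both terms. It makes the functional uniformly convex: near-minimizers
are close together, which gives minimizers and, on comparing two values of `β`, Cauchy estimates. -/
lemma penalized_midpoint (β : ℝ) (f : Lp ℝ 2 m) (v w : E.domain) :
    E.penalized β f ((1 / 2 : ℝ) • (v + w)) =
      (E.penalized β f v + E.penalized β f w) / 2
        - (E.form (v - w) (v - w) + β * ‖((v - w : E.domain) : Lp ℝ 2 m)‖ ^ 2) / 4 := by
  have h1 : ((((1 / 2 : ℝ) • (v + w) : E.domain) : Lp ℝ 2 m) - f)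
      = (1 / 2 : ℝ) • (((v : Lp ℝ 2 m) - f) + ((w : Lp ℝ 2 m) - f)) := by
    push_cast; module
  have h2 : (((v - w : E.domain) : Lp ℝ 2 m)) = ((v : Lp ℝ 2 m) - f) - ((w : Lp ℝ 2 m) - f) := by
    push_cast; abel
  have h3 := parallelogram_law_with_norm ℝ ((v : Lp ℝ 2 m) - f) ((w : Lp ℝ 2 m) - f)
  unfold penalized
  rw [h1, h2, norm_smul, form_smul_self, form_add_self, form_sub_self, mul_pow,
    Real.norm_of_nonneg (by norm_num : (0:ℝ) ≤ 1 / 2)]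
  linear_combination (β / 4) * h3

lemma tendsto_normSq_imp_norm {u : ℕ → E.domain} {f : E.domain}
    (h : Tendsto (fun k => E.normSq (u k - f)) atTop (𝓝 0)) :
    Tendsto (fun k => (u k : Lp ℝ 2 m)) atTop (𝓝 f) := by
  rw [tendsto_iff_norm_sub_tendsto_zero]
  have h2 : Tendsto (fun k => ‖(u k : Lp ℝ 2 m) - f‖ ^ 2) atTop (𝓝 0) :=
    squeeze_zero (fun _ => sq_nonneg _)
      (fun k => by
        have := E.nonneg (u k - f)
        simp only [normSq, Submodule.coe_sub]; linarith) h
  simpa using h2.sqrt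

lemma tendsto_normSq_imp_form_sub {u : ℕ → E.domain} {f : E.domain}
    (h : Tendsto (fun k => E.normSq (u k - f)) atTop (𝓝 0)) :
    Tendsto (fun k => E.form (u k - f) (u k - f)) atTop (𝓝 0) :=
  squeeze_zero (fun k => E.nonneg _)
    (fun k => by
      have := sq_nonneg ‖((u k - f : E.domain) : Lp ℝ 2 m)‖
      simp only [normSq]; linarith) h

lemma tendsto_form_left {u : ℕ → E.domain} {f : E.domain}
    (h : Tendsto (fun k => E.normSq (u k - f)) atTop (𝓝 0)) (v : E.domain) :
    Tendsto (fun k => E.form (u k) v) atTop (𝓝 (E.form f v)) := by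
  rw [tendsto_iff_norm_sub_tendsto_zero]
  have h1 := ((E.tendsto_normSq_imp_form_sub h).mul_const (E.form v v)).sqrt
  simp only [zero_mul, Real.sqrt_zero] at h1
  refine squeeze_zero (fun _ => norm_nonneg _) (fun k => ?_) h1
  rw [← LinearMap.sub_apply, ← map_sub, Real.norm_eq_abs]
  exact Real.abs_le_sqrt (E.form_mul_form_le _ _)

lemma tendsto_form_self {u : ℕ → E.domain} {f : E.domain}
    (h : Tendsto (fun k => E.normSq (u k - f)) atTop (𝓝 0)) :
    Tendsto (fun k => E.form (u k) (u k)) atTop (𝓝 (E.form f f)) := by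
  have h1 := (E.tendsto_normSq_imp_form_sub h).add ((E.tendsto_form_left h f).const_mul 2)
  have h2 := h1.sub_const (E.form f f)
  have e : (0 + 2 * E.form f f - E.form f f) = E.form f f := by ring
  rw [e] at h2
  refine h2.congr fun k => ?_
  rw [form_sub_self]; ring

lemma tendsto_penalized {u : ℕ → E.domain} {w : E.domain}
    (h : Tendsto (fun k => E.normSq (u k - w)) atTop (𝓝 0)) (β : ℝ) (f : Lp ℝ 2 m) :
    Tendsto (fun k => E.penalized β f (u k)) atTop (𝓝 (E.penalized β f w)) :=
  (E.tendsto_form_self h).add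
    ((((E.tendsto_normSq_imp_norm h).sub_const f).norm.pow 2).const_mul β)

lemma exists_penalized_le {β : ℝ} (hβ : 0 < β) (f : Lp ℝ 2 m) :
    ∃ w : E.domain, ∀ v, E.penalized β f w ≤ E.penalized β f v := by
  set I := ⨅ v, E.penalized β f v with hI
  have hbdd : BddBelow (Set.range (E.penalized β f)) :=
    ⟨0, by rintro _ ⟨v, rfl⟩; exact E.penalized_nonneg hβ.le f v⟩
  have hle : ∀ v, I ≤ E.penalized β f v := fun v => ciInf_le hbdd v
  have hex : ∀ k : ℕ, ∃ v, E.penalized β f v < I + 1 / ((k : ℝ) + 1) := fun k =>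
    exists_lt_of_ciInf_lt (lt_add_of_pos_right I (by positivity))
  choose u hu using hex
  have hlim : Tendsto (fun k : ℕ => 1 / ((k : ℝ) + 1)) atTop (𝓝 0) :=
    tendsto_one_div_add_atTop_nhds_zero_nat
  have hmono : ∀ N j : ℕ, N ≤ j → 1 / ((j : ℝ) + 1) ≤ 1 / ((N : ℝ) + 1) := fun N j h =>
    one_div_le_one_div_of_le (by positivity) (by gcongr)
  obtain ⟨w, hw⟩ := E.closed u (by
    intro ε hε
    -- The convexity gap controls `E + β‖·‖²`, and the factor `min 1 β` converts this into the norm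
    -- of the domain. The `4` matches the quarter in the midpoint identity.
    set c := min 1 β with hc
    have hc0 : 0 < c := lt_min one_pos hβ
    obtain ⟨N, hN⟩ := (hlim.eventually (gt_mem_nhds (show (0:ℝ) < c * ε / 4 by positivity))).exists
    refine ⟨N, fun j hj k hk => ?_⟩
    have hmid := E.penalized_midpoint β f (u j) (u k)
    have h1 := hle ((1 / 2 : ℝ) • (u j + u k))
    have h2 := hu j
    have h3 := hu k
    have h4 := hmono N j hj
    have h5 := hmono N k hk
    have h6 : c * (E.form (u j - u k) (u j - u k) + ‖((u j - u k : E.domain) : Lp ℝ 2 m)‖ ^ 2)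
        ≤ E.form (u j - u k) (u j - u k) + β * ‖((u j - u k : E.domain) : Lp ℝ 2 m)‖ ^ 2 := by
      have a1 : c ≤ 1 := min_le_left _ _
      have a2 : c ≤ β := min_le_right _ _
      have := mul_le_mul_of_nonneg_right a1 (E.nonneg (u j - u k))
      have := mul_le_mul_of_nonneg_right a2 (sq_nonneg ‖((u j - u k : E.domain) : Lp ℝ 2 m)‖)
      linarith
    have h7 : c * (E.form (u j - u k) (u j - u k) + ‖((u j - u k : E.domain) : Lp ℝ 2 m)‖ ^ 2)
        < c * ε := by linarith
    have := lt_of_mul_lt_mul_left h7 hc0.le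
    simpa using this)
  refine ⟨w, fun v => le_trans ?_ (hle v)⟩
  have h1 := E.tendsto_penalized (u := u) (w := w) (by simpa [normSq] using hw) β f
  have h2 : Tendsto (fun k : ℕ => I + 1 / ((k : ℝ) + 1)) atTop (𝓝 I) := by
    simpa using hlim.const_add I
  exact le_of_tendsto_of_tendsto' h1 h2 fun k => (hu k).le

lemma penalized_add (β : ℝ) (f : Lp ℝ 2 m) (w v : E.domain) :
    E.penalized β f (w + v) = E.penalized β f w
      + 2 * (E.form w v + β * inner ℝ ((w : Lp ℝ 2 m) - f) (v : Lp ℝ 2 m))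
      + (E.form v v + β * ‖(v : Lp ℝ 2 m)‖ ^ 2) := by
  have h : ((w + v : E.domain) : Lp ℝ 2 m) - f = ((w : Lp ℝ 2 m) - f) + v := by
    push_cast; abel
  unfold penalized
  rw [h, norm_add_sq_real, form_add_self]; ring

lemma exists_weak_solution {β : ℝ} (hβ : 0 < β) (f : Lp ℝ 2 m) :
    ∃ w : E.domain, ∀ v : E.domain,
      E.form w v + β * inner ℝ ((w : Lp ℝ 2 m) - f) (v : Lp ℝ 2 m) = 0 := by
  obtain ⟨w, hw⟩ := E.exists_penalized_le hβ f
  refine ⟨w, fun v => ?_⟩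
  set a := E.form w v + β * inner ℝ ((w : Lp ℝ 2 m) - f) (v : Lp ℝ 2 m) with ha
  set b := E.form v v + β * ‖(v : Lp ℝ 2 m)‖ ^ 2 with hb
  -- First variation in the direction `v`: a quadratic in `t` that is nonnegative and has no
  -- constant term must have zero linear coefficient.
  have key : ∀ t : ℝ, 0 ≤ b * (t * t) + 2 * a * t + 0 := by
    intro t
    have h1 := hw (w + t • v)
    rw [penalized_add, form_smul_self] at h1
    simp only [map_smul, Submodule.coe_smul, inner_smul_right, norm_smul, smul_eq_mul, mul_pow,
      Real.norm_eq_abs, sq_abs] at h1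
    rw [ha, hb]; nlinarith [h1]
  have := discrim_le_zero key
  simp only [discrim] at this
  nlinarith [this]

lemma penalized_le_of_weak_solution {β : ℝ} (hβ : 0 ≤ β) {f : Lp ℝ 2 m} {w : E.domain}
    (hw : ∀ v : E.domain, E.form w v + β * inner ℝ ((w : Lp ℝ 2 m) - f) (v : Lp ℝ 2 m) = 0)
    (v : E.domain) :
    E.penalized β f w + β * ‖((v - w : E.domain) : Lp ℝ 2 m)‖ ^ 2 ≤ E.penalized β f v := by
  have h := E.penalized_add β f w (v - w)
  rw [hw, add_sub_cancel] at h
  have := E.nonneg (v - w)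
  linarith

/-- The operator `f ↦ β G_β f`, with values in the domain. -/
noncomputable def resolvent (β : ℝ) (hβ : 0 < β) (f : Lp ℝ 2 m) : E.domain :=
  (E.exists_weak_solution hβ f).choose

lemma resolvent_spec (β : ℝ) (hβ : 0 < β) (f : Lp ℝ 2 m) (v : E.domain) :
    E.form (E.resolvent β hβ f) v
      + β * inner ℝ ((E.resolvent β hβ f : Lp ℝ 2 m) - f) (v : Lp ℝ 2 m) = 0 :=
  (E.exists_weak_solution hβ f).choose_spec v

lemma eq_resolvent {β : ℝ} (hβ : 0 < β) {f : Lp ℝ 2 m} {w : E.domain}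
    (hw : ∀ v : E.domain, E.form w v + β * inner ℝ ((w : Lp ℝ 2 m) - f) (v : Lp ℝ 2 m) = 0) :
    w = E.resolvent β hβ f := by
  have h1 := E.penalized_le_of_weak_solution hβ.le hw (E.resolvent β hβ f)
  have h2 := E.penalized_le_of_weak_solution hβ.le (E.resolvent_spec β hβ f) w
  rw [← norm_neg] at h1
  rw [← Submodule.coe_neg, neg_sub] at h1
  have h3 : ‖((w - E.resolvent β hβ f : E.domain) : Lp ℝ 2 m)‖ ^ 2 ≤ 0 := by
    by_contra hc
    push Not at hc
    have := mul_pos hβ hc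
    linarith
  have h4 : ‖((w - E.resolvent β hβ f : E.domain) : Lp ℝ 2 m)‖ = 0 := by
    nlinarith [norm_nonneg ((w - E.resolvent β hβ f : E.domain) : Lp ℝ 2 m)]
  rw [norm_eq_zero, Submodule.coe_eq_zero, sub_eq_zero] at h4
  exact h4

/-- The Markovian contraction `β G_β` of `L²`. -/
noncomputable def resolventL (β : ℝ) (hβ : 0 < β) : Lp ℝ 2 m →ₗ[ℝ] Lp ℝ 2 m where
  toFun f := E.resolvent β hβ f
  map_add' f g := by
    rw [← Submodule.coe_add]
    congr 1
    refine (E.eq_resolvent hβ fun v => ?_).symm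
    have h1 := E.resolvent_spec β hβ f v
    have h2 := E.resolvent_spec β hβ g v
    simp only [map_add, LinearMap.add_apply, Submodule.coe_add, inner_sub_left,
      inner_add_left] at *
    linear_combination h1 + h2
  map_smul' c f := by
    simp only [RingHom.id_apply]
    rw [← Submodule.coe_smul]
    congr 1
    refine (E.eq_resolvent hβ fun v => ?_).symm
    have h1 := E.resolvent_spec β hβ f v
    simp only [map_smul, LinearMap.smul_apply, Submodule.coe_smul, inner_sub_left,
      real_inner_smul_left, smul_eq_mul] at *
    linear_combination c * h1

lemma resolventL_apply (β : ℝ) (hβ : 0 < β) (f : Lp ℝ 2 m) :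
    E.resolventL β hβ f = E.resolvent β hβ f := rfl

lemma inner_resolventL (β : ℝ) (hβ : 0 < β) (f g : Lp ℝ 2 m) :
    inner ℝ (E.resolventL β hβ f) g = inner ℝ f (E.resolventL β hβ g) := by
  have h1 := E.resolvent_spec β hβ f (E.resolvent β hβ g)
  have h2 := E.resolvent_spec β hβ g (E.resolvent β hβ f)
  rw [E.symm, inner_sub_left] at h1
  rw [inner_sub_left, real_inner_comm] at h2
  simp only [resolventL_apply]
  have h3 : β * (inner ℝ f (E.resolvent β hβ g : Lp ℝ 2 m)
      - inner ℝ g (E.resolvent β hβ f : Lp ℝ 2 m)) = 0 := by linear_combination h2 - h1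
  rw [real_inner_comm]
  have := (mul_eq_zero.1 h3).resolve_left hβ.ne'
  linarith

lemma norm_resolventL_le (β : ℝ) (hβ : 0 < β) (f : Lp ℝ 2 m) :
    ‖E.resolventL β hβ f‖ ≤ ‖f‖ := by
  have h1 := E.resolvent_spec β hβ f (E.resolvent β hβ f)
  rw [inner_sub_left, real_inner_self_eq_norm_sq] at h1
  have h2 := E.nonneg (E.resolvent β hβ f)
  have h3 := real_inner_le_norm f (E.resolvent β hβ f : Lp ℝ 2 m)
  rw [resolventL_apply]
  have h4 : β * (‖(E.resolvent β hβ f : Lp ℝ 2 m)‖ ^ 2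
      - inner ℝ f (E.resolvent β hβ f : Lp ℝ 2 m)) ≤ 0 := by linarith
  have h5 := nonpos_of_mul_nonpos_right h4 hβ
  by_contra hc
  push Not at hc
  nlinarith [norm_nonneg f]

/-- The approximating form `β ⟪u - β G_β u, u⟫`. -/
lemma inner_sub_resolventL_self (β : ℝ) (hβ : 0 < β) (u : Lp ℝ 2 m) :
    β * inner ℝ (u - E.resolventL β hβ u) u = E.penalized β u (E.resolvent β hβ u) := by
  have h1 := E.resolvent_spec β hβ u (E.resolvent β hβ u)
  rw [penalized, resolventL_apply, ← real_inner_self_eq_norm_sq]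
  simp only [inner_sub_left, inner_sub_right] at *
  rw [real_inner_comm u (E.resolvent β hβ u : Lp ℝ 2 m)] at *
  linear_combination -h1

lemma form_resolvent (β : ℝ) (hβ : 0 < β) (u : Lp ℝ 2 m) (v : E.domain) :
    E.form (E.resolvent β hβ u) v = β * inner ℝ (u - E.resolventL β hβ u) (v : Lp ℝ 2 m) := by
  have h1 := E.resolvent_spec β hβ u v
  rw [resolventL_apply]
  simp only [inner_sub_left] at *
  linear_combination h1

lemma inner_sub_resolventL_self_le (β : ℝ) (hβ : 0 < β) (u : E.domain) :
    β * inner ℝ ((u : Lp ℝ 2 m) - E.resolventL β hβ u) u ≤ E.form u u := by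
  have h := E.penalized_le_of_weak_solution hβ.le (E.resolvent_spec β hβ u) u
  rw [inner_sub_resolventL_self]
  have h2 : 0 ≤ β * ‖((u - E.resolvent β hβ u : E.domain) : Lp ℝ 2 m)‖ ^ 2 := by positivity
  have h3 : E.penalized β u u = E.form u u := by simp [penalized]
  linarith

/-- The resolvent operators along `β = k + 1`. -/
noncomputable abbrev resSeq (k : ℕ) : Lp ℝ 2 m →ₗ[ℝ] Lp ℝ 2 m :=
  E.resolventL ((k : ℝ) + 1) (by positivity)

/-- The bounded quantity is the minimum `M k` of the penalized functional at `β = k + 1`. It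
increases with `β`, so it converges, and the midpoint identity gives `normSq (w j - w k) ≤ 2 (M k -
M j)` for `j ≤ k`; here `β ≥ 1` is used. Closedness yields a limit in the domain, and the penalty
term, bounded by `C`, forces this limit to be `u`. -/
lemma exists_domain_of_bounded {u : Lp ℝ 2 m} {C : ℝ}
    (hC : ∀ k : ℕ, ((k : ℝ) + 1) * inner ℝ (u - E.resSeq k u) u ≤ C) :
    ∃ f : E.domain, (f : Lp ℝ 2 m) = u ∧ E.form f f ≤ C ∧
      Tendsto (fun k : ℕ => E.normSq (E.resolvent ((k : ℝ) + 1) (by positivity) u - f))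
        atTop (𝓝 0) := by
  set w : ℕ → E.domain := fun k => E.resolvent ((k : ℝ) + 1) (by positivity) u with hw
  set M : ℕ → ℝ := fun k => E.penalized ((k : ℝ) + 1) u (w k) with hM
  have hMC : ∀ k, M k ≤ C := fun k => by
    have := hC k
    rwa [resSeq, inner_sub_resolventL_self] at this
  have hmin : ∀ k (v : E.domain), M k ≤ E.penalized ((k : ℝ) + 1) u v := fun k v => by
    have h0 : (0 : ℝ) < (k : ℝ) + 1 := by positivity
    have h := E.penalized_le_of_weak_solution h0.le (E.resolvent_spec _ h0 u) v
    exact le_trans (le_add_of_nonneg_right (by positivity)) h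
  have hpm : ∀ j k : ℕ, j ≤ k → ∀ v : E.domain,
      E.penalized ((j : ℝ) + 1) u v ≤ E.penalized ((k : ℝ) + 1) u v := fun j k hjk v => by
    unfold penalized; gcongr
  have hmono : Monotone M := fun j k hjk => (hmin j (w k)).trans (hpm j k hjk _)
  have hconv := tendsto_atTop_ciSup hmono ⟨C, by rintro _ ⟨k, rfl⟩; exact hMC k⟩
  set L := ⨆ k, M k
  have hML : ∀ k, M k ≤ L := fun k => le_ciSup ⟨C, by rintro _ ⟨k, rfl⟩; exact hMC k⟩ k
  have hdiff : ∀ j k : ℕ, j ≤ k → E.normSq (w j - w k) ≤ 2 * (M k - M j) := fun j k hjk => by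
    have h1 := E.penalized_midpoint ((j : ℝ) + 1) u (w j) (w k)
    have h2 := hmin j ((1 / 2 : ℝ) • (w j + w k))
    have h3 := hpm j k hjk (w k)
    have h4 : (0 : ℝ) ≤ j * ‖((w j - w k : E.domain) : Lp ℝ 2 m)‖ ^ 2 := by positivity
    simp only [normSq]
    simp only [hM] at *
    linarith
  obtain ⟨f, hf⟩ := E.closed w (by
    intro ε hε
    obtain ⟨N, hN⟩ := (hconv.eventually (lt_mem_nhds (show L - ε / 2 < L by linarith))).exists
    refine ⟨N, fun j hj k hk => ?_⟩
    have hj' := hmono hj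
    have hk' := hmono hk
    have e1 := hML j
    have e2 := hML k
    rcases le_total j k with h | h
    · have := hdiff j k h
      simp only [normSq] at this
      simp only [Submodule.coe_sub] at *
      linarith
    · have := hdiff k j h
      rw [show w k - w j = -(w j - w k) by abel] at this
      simp only [normSq, map_neg, LinearMap.neg_apply, neg_neg, Submodule.coe_neg,
        norm_neg] at this
      simp only [Submodule.coe_sub] at *
      linarith)
  have hf' : Tendsto (fun k => E.normSq (w k - f)) atTop (𝓝 0) := by simpa [normSq] using hf
  have hwu : Tendsto (fun k => (w k : Lp ℝ 2 m)) atTop (𝓝 u) := by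
    rw [tendsto_iff_norm_sub_tendsto_zero]
    have h0 : Tendsto (fun k : ℕ => C * (1 / ((k : ℝ) + 1))) atTop (𝓝 0) := by
      simpa using tendsto_one_div_add_atTop_nhds_zero_nat.const_mul C
    have h1 : Tendsto (fun k => ‖(w k : Lp ℝ 2 m) - u‖ ^ 2) atTop (𝓝 0) := by
      refine squeeze_zero (fun _ => sq_nonneg _) (fun k => ?_) h0
      have h2 := hMC k
      have h3 := E.nonneg (w k)
      simp only [hM, penalized] at h2
      rw [mul_one_div, le_div_iff₀ (by positivity)]
      linarith
    simpa using h1.sqrt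
  have hfu : (f : Lp ℝ 2 m) = u := tendsto_nhds_unique (E.tendsto_normSq_imp_norm hf') hwu
  refine ⟨f, hfu, ?_, hf'⟩
  refine le_of_tendsto' (E.tendsto_form_self hf') fun k => ?_
  have h2 := hMC k
  simp only [hM, penalized] at h2
  have : 0 ≤ ((k : ℝ) + 1) * ‖(w k : Lp ℝ 2 m) - u‖ ^ 2 := by positivity
  linarith

lemma tendsto_inner_sub_resSeq (u v : E.domain) :
    Tendsto (fun k : ℕ => ((k : ℝ) + 1) * inner ℝ ((u : Lp ℝ 2 m) - E.resSeq k u) (v : Lp ℝ 2 m))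
      atTop (𝓝 (E.form u v)) := by
  obtain ⟨f, hf, -, h⟩ := E.exists_domain_of_bounded (u := u) (C := E.form u u)
    (fun k => E.inner_sub_resolventL_self_le _ _ u)
  obtain rfl : f = u := Subtype.ext hf
  refine (E.tendsto_form_left h v).congr fun k => ?_
  rw [form_resolvent]

/-- The unit contraction moves the resolvent no farther from a function with values in `[0,1]` and
does not raise the energy. The contracted function is therefore also a minimizer, and minimizers are
unique. -/
lemma resolventL_unit_interval (β : ℝ) (hβ : 0 < β) {f : Lp ℝ 2 m}
    (hf : ∀ᵐ x ∂m, 0 ≤ f x ∧ f x ≤ 1) :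
    ∀ᵐ x ∂m, 0 ≤ E.resolventL β hβ f x ∧ E.resolventL β hβ f x ≤ 1 := by
  obtain ⟨v, hv, hvE⟩ := E.markov (E.resolvent β hβ f)
  have hnorm : ‖(v : Lp ℝ 2 m) - f‖ ≤ ‖(E.resolvent β hβ f : Lp ℝ 2 m) - f‖ := by
    refine Lp.norm_le_norm_of_ae_le ?_
    filter_upwards [hv, hf, Lp.coeFn_sub (v : Lp ℝ 2 m) f,
      Lp.coeFn_sub (E.resolvent β hβ f : Lp ℝ 2 m) f] with x h1 h2 h3 h4
    rw [h3, h4]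
    simp only [Pi.sub_apply, h1, Real.norm_eq_abs]
    set t := (E.resolvent β hβ f : Lp ℝ 2 m) x
    obtain ⟨h5, h6⟩ := h2
    rcases le_total t 0 with h | h
    · rw [max_eq_right h, min_eq_left zero_le_one, abs_of_nonpos (by linarith),
        abs_of_nonpos (by linarith)]; linarith
    · rw [max_eq_left h]
      rcases le_total t 1 with h' | h'
      · rw [min_eq_left h']
      · rw [min_eq_right h', abs_of_nonneg (by linarith), abs_of_nonneg (by linarith)]; linarith
  have h1 := E.penalized_le_of_weak_solution hβ.le (E.resolvent_spec β hβ f) v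
  have h2 : E.penalized β f v ≤ E.penalized β f (E.resolvent β hβ f) := by
    unfold penalized; gcongr
  have h3 : ‖((v - E.resolvent β hβ f : E.domain) : Lp ℝ 2 m)‖ ^ 2 ≤ 0 :=
    nonpos_of_mul_nonpos_right (by linarith) hβ
  have h4 : ‖((v - E.resolvent β hβ f : E.domain) : Lp ℝ 2 m)‖ = 0 := by
    nlinarith [norm_nonneg ((v - E.resolvent β hβ f : E.domain) : Lp ℝ 2 m)]
  rw [norm_eq_zero, Submodule.coe_eq_zero, sub_eq_zero] at h4
  rw [resolventL_apply]
  filter_upwards [hv] with x hx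
  rw [h4] at hx
  rw [hx]
  exact ⟨le_min (le_max_right _ _) zero_le_one, min_le_right _ _⟩

end Resolvent

end DirichletForm

/-! ### Pairings in `L²` and truncation to sets of finite measure. -/

section L2

variable {X : Type*} [MeasurableSpace X] {m : Measure X}

lemma L2_inner_eq_integral (f g : Lp ℝ 2 m) : inner ℝ f g = ∫ x, f x * g x ∂m := by
  rw [L2.inner_def]
  refine integral_congr_ae (Eventually.of_forall fun x => ?_)
  simp [mul_comm]

lemma L2_integrable_mul (f g : Lp ℝ 2 m) : Integrable (fun x => f x * g x) m := by
  refine (L2.integrable_inner (𝕜 := ℝ) f g).congr (Eventually.of_forall fun x => ?_)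
  simp [mul_comm]

lemma L2_inner_congr {f g f' g' : Lp ℝ 2 m} (h : ∀ᵐ x ∂m, f x * g x = f' x * g' x) :
    inner ℝ f g = inner ℝ f' g' := by
  rw [L2_inner_eq_integral, L2_inner_eq_integral]
  exact integral_congr_ae h

lemma L2_inner_mono {f g f' g' : Lp ℝ 2 m} (h : ∀ᵐ x ∂m, f x * g x ≤ f' x * g' x) :
    inner ℝ f g ≤ inner ℝ f' g' := by
  rw [L2_inner_eq_integral, L2_inner_eq_integral]
  exact integral_mono_ae (L2_integrable_mul f g) (L2_integrable_mul f' g') h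

/-- Essentially bounded elements of `L²`. -/
def EssBdd (u : Lp ℝ 2 m) : Prop := ∃ C : ℝ, ∀ᵐ x ∂m, |u x| ≤ C

lemma exists_L2_of_abs_le {f : X → ℝ} (hf : AEStronglyMeasurable f m) (u : Lp ℝ 2 m) {C : ℝ}
    (h : ∀ᵐ x ∂m, |f x| ≤ C * |u x|) : ∃ w : Lp ℝ 2 m, w =ᵐ[m] f := by
  have : MemLp f 2 m := MemLp.of_le_mul (Lp.memLp u) hf (by simpa using h)
  exact ⟨this.toLp f, this.coeFn_toLp⟩

lemma exists_L2_mul (u v : Lp ℝ 2 m) (hu : EssBdd u) :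
    ∃ w : Lp ℝ 2 m, w =ᵐ[m] fun x => u x * v x := by
  obtain ⟨C, hC⟩ := hu
  refine exists_L2_of_abs_le ((Lp.aestronglyMeasurable u).mul (Lp.aestronglyMeasurable v)) v
    (C := C) ?_
  filter_upwards [hC] with x hx
  rw [abs_mul]; gcongr

lemma exists_subseq_tendsto_ae {f : ℕ → Lp ℝ 2 m} {g : Lp ℝ 2 m}
    (h : Tendsto f atTop (𝓝 g)) : ∃ ns : ℕ → ℕ, StrictMono ns ∧
      ∀ᵐ x ∂m, Tendsto (fun k => f (ns k) x) atTop (𝓝 (g x)) :=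
  (tendstoInMeasure_of_tendsto_Lp h).exists_seq_tendsto_ae

variable [SigmaFinite m]

/-- The restriction of an `L²` function to the `k`-th spanning set. -/
noncomputable def spanCut (k : ℕ) (u : Lp ℝ 2 m) : Lp ℝ 2 m :=
  ((Lp.memLp u).indicator (measurableSet_spanningSets m k)).toLp _

lemma coeFn_spanCut (k : ℕ) (u : Lp ℝ 2 m) :
    spanCut k u =ᵐ[m] (spanningSets m k).indicator u := MemLp.coeFn_toLp _

variable (m) in
/-- The indicator of the `k`-th spanning set. -/
noncomputable def spanOne (k : ℕ) : Lp ℝ 2 m :=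
  indicatorConstLp 2 (measurableSet_spanningSets m k) (measure_spanningSets_lt_top m k).ne 1

lemma coeFn_spanOne (k : ℕ) :
    spanOne m k =ᵐ[m] (spanningSets m k).indicator fun _ => 1 := indicatorConstLp_coeFn

lemma spanCut_eq (k : ℕ) (u : Lp ℝ 2 m) : ∀ᵐ x ∂m, spanCut k u x = spanOne m k x * u x := by
  filter_upwards [coeFn_spanCut k u, coeFn_spanOne (m := m) k] with x h1 h2
  rw [h1, h2]; by_cases hx : x ∈ spanningSets m k <;> simp [hx]

lemma spanOne_eq (k : ℕ) : ∀ᵐ x ∂m, spanOne m k x = 0 ∨ spanOne m k x = 1 := by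
  filter_upwards [coeFn_spanOne (m := m) k] with x h2
  rw [h2]; by_cases hx : x ∈ spanningSets m k <;> simp [hx]

lemma tendsto_spanCut (u : Lp ℝ 2 m) : Tendsto (fun k => spanCut k u) atTop (𝓝 u) := by
  rw [tendsto_iff_norm_sub_tendsto_zero]
  have h1 : Tendsto (fun k => ∫ x, ((spanningSets m k).indicator u x - u x) *
      ((spanningSets m k).indicator u x - u x) ∂m) atTop (𝓝 (∫ x, (0 : ℝ) ∂m)) := by
    refine tendsto_integral_of_dominated_convergence (fun x => u x * u x) (fun k => ?_)
      (L2_integrable_mul u u) (fun k => Eventually.of_forall fun x => ?_)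
      (Eventually.of_forall fun x => ?_)
    · have : AEStronglyMeasurable ((spanningSets m k).indicator u) m :=
        (Lp.aestronglyMeasurable u).indicator (measurableSet_spanningSets m k)
      exact (this.sub (Lp.aestronglyMeasurable u)).mul (this.sub (Lp.aestronglyMeasurable u))
    · by_cases hx : x ∈ spanningSets m k <;> simp [hx, mul_self_nonneg]
    · refine tendsto_const_nhds.congr' ?_
      filter_upwards [eventually_ge_atTop (spanningSetsIndex m x)] with k hk
      have : x ∈ spanningSets m k :=
        monotone_spanningSets m hk (mem_spanningSetsIndex m x)
      simp [this]
  simp only [integral_zero] at h1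
  have h2 := h1.sqrt
  rw [Real.sqrt_zero] at h2
  refine h2.congr fun k => ?_
  rw [norm_eq_sqrt_real_inner (spanCut k u - u), L2_inner_eq_integral]
  congr 1
  refine integral_congr_ae ?_
  filter_upwards [coeFn_spanCut k u, Lp.coeFn_sub (spanCut k u) u] with x h1 h2
  rw [h2, Pi.sub_apply, h1]

end L2

/-! ### The squared gradient of a symmetric Markovian operator. -/

/-- Symmetric Markovian contractions of `L²`. -/
structure IsMarkovOp {X : Type*} [MeasurableSpace X] {m : Measure X}
    (S : Lp ℝ 2 m →ₗ[ℝ] Lp ℝ 2 m) : Prop where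
  symm : ∀ f g, inner ℝ (S f) g = inner ℝ f (S g)
  norm_le : ∀ f, ‖S f‖ ≤ ‖f‖
  unit_interval : ∀ f : Lp ℝ 2 m, (∀ᵐ x ∂m, 0 ≤ f x ∧ f x ≤ 1) →
    ∀ᵐ x ∂m, 0 ≤ S f x ∧ S f x ≤ 1

namespace IsMarkovOp

variable {X : Type*} [MeasurableSpace X] {m : Measure X} {S : Lp ℝ 2 m →ₗ[ℝ] Lp ℝ 2 m}

lemma tendsto (hS : IsMarkovOp S) {f : ℕ → Lp ℝ 2 m} {g : Lp ℝ 2 m}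
    (h : Tendsto f atTop (𝓝 g)) : Tendsto (fun k => S (f k)) atTop (𝓝 (S g)) := by
  rw [tendsto_iff_norm_sub_tendsto_zero] at h ⊢
  refine squeeze_zero (fun _ => norm_nonneg _) (fun k => ?_) h
  rw [← map_sub]
  exact hS.norm_le _

/-- Rescaling into `[0,1]`; the upper bound is there because the Markov property is only given on
that interval. -/
lemma nonneg (hS : IsMarkovOp S) {f : Lp ℝ 2 m} {C : ℝ} (h0 : ∀ᵐ x ∂m, 0 ≤ f x)
    (hC : ∀ᵐ x ∂m, f x ≤ C) : ∀ᵐ x ∂m, 0 ≤ S f x := by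
  set D := max C 1 with hD
  have hD0 : 0 < D := lt_of_lt_of_le one_pos (le_max_right _ _)
  have h1 := hS.unit_interval (D⁻¹ • f) (by
    filter_upwards [h0, hC, Lp.coeFn_smul D⁻¹ f] with x h1 h2 h3
    rw [h3, Pi.smul_apply, smul_eq_mul]
    refine ⟨by positivity, ?_⟩
    rw [inv_mul_le_iff₀ hD0, mul_one]
    exact h2.trans (le_max_left _ _))
  rw [map_smul] at h1
  filter_upwards [h1, Lp.coeFn_smul D⁻¹ (S f)] with x h1 h3
  rw [h3, Pi.smul_apply, smul_eq_mul] at h1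
  exact (mul_nonneg_iff_of_pos_left (inv_pos.2 hD0)).1 h1.1

variable [SigmaFinite m]

omit [SigmaFinite m] in
lemma coeFn_combo (u2 ue e t2 te : Lp ℝ 2 m) (a b L : ℝ) :
    ∀ᵐ x ∂m, (L ^ 2 • (u2 - (2 * a) • ue + a ^ 2 • e) - (t2 - (2 * b) • te + b ^ 2 • e) :
      Lp ℝ 2 m) x = L ^ 2 * (u2 x - 2 * a * ue x + a ^ 2 * e x)
        - (t2 x - 2 * b * te x + b ^ 2 * e x) := by
  filter_upwards [Lp.coeFn_sub (L ^ 2 • (u2 - (2 * a) • ue + a ^ 2 • e))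
      (t2 - (2 * b) • te + b ^ 2 • e), Lp.coeFn_smul (L ^ 2) (u2 - (2 * a) • ue + a ^ 2 • e),
    Lp.coeFn_add (u2 - (2 * a) • ue) (a ^ 2 • e), Lp.coeFn_add (t2 - (2 * b) • te) (b ^ 2 • e),
    Lp.coeFn_sub u2 ((2 * a) • ue), Lp.coeFn_sub t2 ((2 * b) • te),
    Lp.coeFn_smul (a ^ 2) e, Lp.coeFn_smul (b ^ 2) e, Lp.coeFn_smul (2 * a) ue,
    Lp.coeFn_smul (2 * b) te] with x h1 h2 h3 h4 h5 h6 h7 h8 h9 h10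
  simp only [h1, h2, h3, h4, h5, h6, h7, h8, h9, h10, Pi.sub_apply, Pi.add_apply, Pi.smul_apply,
    smul_eq_mul]

/-- Lipschitz functions contract the pointwise squared gradient of a Markovian operator. -/
lemma carre_lipschitz (hS : IsMarkovOp S) {T : ℝ → ℝ} {L : ℝ}
    (hT : ∀ a b, |T a - T b| ≤ L * |a - b|) (hT0 : T 0 = 0) {u t u2 t2 : Lp ℝ 2 m}
    (hu : EssBdd u) (ht : ∀ᵐ x ∂m, t x = T (u x)) (hu2 : ∀ᵐ x ∂m, u2 x = u x ^ 2)
    (ht2 : ∀ᵐ x ∂m, t2 x = t x ^ 2) :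
    ∀ᵐ x ∂m, S t2 x - 2 * (t x * S t x) + t2 x ≤ L ^ 2 * (S u2 x - 2 * (u x * S u x) + u2 x) := by
  obtain ⟨C, hC⟩ := hu
  have hTsq : ∀ a b, (T a - T b) ^ 2 ≤ L ^ 2 * (a - b) ^ 2 := fun a b => by
    have := pow_le_pow_left₀ (abs_nonneg _) (hT a b) 2
    rwa [mul_pow, sq_abs, sq_abs] at this
  have hTsq0 : ∀ a, T a ^ 2 ≤ L ^ 2 * a ^ 2 := fun a => by simpa [hT0] using hTsq a 0
  -- Formally, `S` is applied to `(T u - T a)² ≤ L² (u - a)²` for a constant `a`. Since `1` need not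
  -- lie in `L²`, the indicator of a spanning set replaces it; off that set the inequality reduces
  -- to `T(u)² ≤ L² u²`.
  have step : ∀ (a : ℝ) (k : ℕ), ∀ᵐ x ∂m,
      0 ≤ L ^ 2 * (S u2 x - 2 * a * S (spanCut k u) x + a ^ 2)
        - (S t2 x - 2 * T a * S (spanCut k t) x + T a ^ 2) := by
    intro a k
    have h1 := hS.nonneg (f := L ^ 2 • (u2 - (2 * a) • spanCut k u + a ^ 2 • spanOne m k)
        - (t2 - (2 * T a) • spanCut k t + T a ^ 2 • spanOne m k)) (C := L ^ 2 * (C + |a|) ^ 2)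
      (by
        filter_upwards [coeFn_combo u2 (spanCut k u) (spanOne m k) t2 (spanCut k t) a (T a) L,
          spanCut_eq k u, spanCut_eq k t, spanOne_eq (m := m) k, ht, hu2, ht2]
          with x h1 h2 h3 h4 h5 h6 h7
        rw [h1, h2, h3, h6, h7, h5]
        rcases h4 with h4 | h4 <;> rw [h4]
        · have := hTsq0 (u x); nlinarith
        · have := hTsq (u x) a; nlinarith)
      (by
        filter_upwards [coeFn_combo u2 (spanCut k u) (spanOne m k) t2 (spanCut k t) a (T a) L,
          spanCut_eq k u, spanCut_eq k t, spanOne_eq (m := m) k, ht, hu2, ht2, hC]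
          with x h1 h2 h3 h4 h5 h6 h7 h8
        rw [h1, h2, h3, h6, h7, h5]
        have hC0 := (abs_nonneg _).trans h8
        rcases h4 with h4 | h4 <;> rw [h4]
        · have hh : u x ^ 2 ≤ (C + |a|) ^ 2 := by
            rw [← sq_abs (u x)]
            exact pow_le_pow_left₀ (abs_nonneg _) (by linarith [abs_nonneg a]) 2
          have := mul_le_mul_of_nonneg_left hh (sq_nonneg L)
          nlinarith [sq_nonneg (T (u x))]
        · have hh : (u x - a) ^ 2 ≤ (C + |a|) ^ 2 := by
            rw [← sq_abs (u x - a)]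
            exact pow_le_pow_left₀ (abs_nonneg _) ((abs_sub _ _).trans (by linarith)) 2
          have := mul_le_mul_of_nonneg_left hh (sq_nonneg L)
          nlinarith [sq_nonneg (T (u x) - T a)])
    simp only [map_sub, map_add, map_smul] at h1
    have h2 := hS.unit_interval (spanOne m k) (by
      filter_upwards [spanOne_eq (m := m) k] with x hx
      rcases hx with hx | hx <;> rw [hx] <;> norm_num)
    filter_upwards [h1, h2, coeFn_combo (S u2) (S (spanCut k u)) (S (spanOne m k)) (S t2)
      (S (spanCut k t)) a (T a) L] with x h1 h2 h3
    rw [h3] at h1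
    -- The image of the indicator is at most `1`, and its coefficient `L² a² - T(a)²` is
    -- nonnegative, so it may be replaced by `1`.
    have h4 := mul_le_mul_of_nonneg_right h2.2 (sub_nonneg.2 (hTsq0 a))
    nlinarith
  obtain ⟨n1, hn1, hl1⟩ := exists_subseq_tendsto_ae (hS.tendsto (tendsto_spanCut u))
  obtain ⟨n2, hn2, hl2⟩ := exists_subseq_tendsto_ae
    ((hS.tendsto (tendsto_spanCut t)).comp hn1.tendsto_atTop)
  have step2 : ∀ᵐ x ∂m, ∀ (q : ℚ), ∀ k : ℕ,
      0 ≤ L ^ 2 * (S u2 x - 2 * q * S (spanCut k u) x + (q : ℝ) ^ 2)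
        - (S t2 x - 2 * T q * S (spanCut k t) x + T q ^ 2) :=
    ae_all_iff.2 fun q => ae_all_iff.2 fun k => step q k
  have hTc : Continuous T := by
    have : LipschitzWith (Real.toNNReal L) T := LipschitzWith.of_dist_le_mul fun a b => by
      rw [Real.dist_eq, Real.dist_eq]
      refine (hT a b).trans (mul_le_mul_of_nonneg_right (Real.le_coe_toNNReal L) (abs_nonneg _))
    exact this.continuous
  filter_upwards [step2, hl1, hl2, ht, hu2, ht2] with x h1 h2 h3 h4 h5 h6
  have h7 : ∀ q : ℚ, 0 ≤ L ^ 2 * (S u2 x - 2 * q * S u x + (q : ℝ) ^ 2)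
        - (S t2 x - 2 * T q * S t x + T q ^ 2) := by
    intro q
    have h8 := h2.comp hn2.tendsto_atTop
    refine ge_of_tendsto' ((((h8.const_mul (2 * (q : ℝ))).const_sub (S u2 x)).add_const
      ((q : ℝ) ^ 2)).const_mul (L ^ 2) |>.sub
      (((h3.const_mul (2 * T q)).const_sub (S t2 x)).add_const (T q ^ 2))) fun k => ?_
    exact h1 q (n1 (n2 k))
  have h9 : ∀ a : ℝ, 0 ≤ L ^ 2 * (S u2 x - 2 * a * S u x + a ^ 2)
        - (S t2 x - 2 * T a * S t x + T a ^ 2) := by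
    intro a
    have hcl : IsClosed {a : ℝ | 0 ≤ L ^ 2 * (S u2 x - 2 * a * S u x + a ^ 2)
        - (S t2 x - 2 * T a * S t x + T a ^ 2)} := isClosed_le continuous_const (by fun_prop)
    have : a ∈ closure (Set.range ((↑) : ℚ → ℝ)) := Rat.isDenseEmbedding_coe_real.dense a
    exact hcl.closure_subset_iff.2 (by rintro _ ⟨q, rfl⟩; exact h7 q) this
  -- The exceptional set no longer depends on `a`, which makes the choice `a = u x` legitimate.
  have := h9 (u x)
  rw [h5, h6, h4]
  rw [h4] at *
  linarith

variable {u t u2 t2 p : Lp ℝ 2 m}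

omit [SigmaFinite m] in
lemma inner_carre_eq (hS : IsMarkovOp S) {φ φu : Lp ℝ 2 m}
    (hφu : ∀ᵐ x ∂m, φu x = φ x * u x) (hp : ∀ᵐ x ∂m, p x = u x * S u x) :
    inner ℝ φ (S u2 - (2 : ℝ) • p + u2)
      = inner ℝ (S φ) u2 - 2 * inner ℝ φu (S u) + inner ℝ φ u2 := by
  rw [inner_add_right, inner_sub_right, inner_smul_right, hS.symm]
  congr 3
  refine L2_inner_congr ?_
  filter_upwards [hφu, hp] with x h1 h2
  rw [h1, h2]; ring

omit [SigmaFinite m] in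
lemma coeFn_carre (S : Lp ℝ 2 m →ₗ[ℝ] Lp ℝ 2 m) (u u2 p : Lp ℝ 2 m)
    (hp : ∀ᵐ x ∂m, p x = u x * S u x) :
    ∀ᵐ x ∂m, (S u2 - (2 : ℝ) • p + u2 : Lp ℝ 2 m) x = S u2 x - 2 * (u x * S u x) + u2 x := by
  filter_upwards [hp, Lp.coeFn_add (S u2 - (2 : ℝ) • p) u2, Lp.coeFn_sub (S u2) ((2 : ℝ) • p),
    Lp.coeFn_smul (2 : ℝ) p] with x h1 h2 h3 h4
  simp only [h2, h3, h4, h1, Pi.add_apply, Pi.sub_apply, Pi.smul_apply, smul_eq_mul]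

/-- Accounts for the loss of mass of `S`: twice the approximating form is the integrated squared
gradient plus a killing term with weight `1 - S 1`. This inequality handles the killing term with
truncated constants. -/
lemma integral_le_two_norm_sq (hS : IsMarkovOp S) (k : ℕ) {w : X → ℝ} (hw : Integrable w m)
    (hw0 : ∀ᵐ x ∂m, 0 ≤ w x) :
    ∫ x, spanOne m k x * w x ∂m + ∫ x, S (spanOne m k) x * w x ∂m ≤ 2 * ∫ x, w x ∂m := by
  have h2 := hS.unit_interval (spanOne m k) (by
      filter_upwards [spanOne_eq (m := m) k] with x hx
      rcases hx with hx | hx <;> rw [hx] <;> norm_num)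
  have h3 : ∀ v : Lp ℝ 2 m, (∀ᵐ x ∂m, 0 ≤ v x ∧ v x ≤ 1) → ∫ x, v x * w x ∂m ≤ ∫ x, w x ∂m := by
    intro v hv
    refine integral_mono_of_nonneg ?_ hw ?_
    · filter_upwards [hv, hw0] with x h1 h2 using mul_nonneg h1.1 h2
    · filter_upwards [hv, hw0] with x h1 h2 using mul_le_of_le_one_left h2 h1.2
  have h4 := h3 _ h2
  have h5 := h3 (spanOne m k) (by
      filter_upwards [spanOne_eq (m := m) k] with x hx
      rcases hx with hx | hx <;> rw [hx] <;> norm_num)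
  linarith

/-- Lipschitz functions operate on the approximating forms. -/
lemma inner_lipschitz_le (hS : IsMarkovOp S) {T : ℝ → ℝ} {L : ℝ}
    (hT : ∀ a b, |T a - T b| ≤ L * |a - b|) (hT0 : T 0 = 0) (hu : EssBdd u)
    (ht : ∀ᵐ x ∂m, t x = T (u x)) :
    inner ℝ (t - S t) t ≤ L ^ 2 * inner ℝ (u - S u) u := by
  have hTsq0 : ∀ a, T a ^ 2 ≤ L ^ 2 * a ^ 2 := fun a => by
    have := pow_le_pow_left₀ (abs_nonneg _) (hT a 0) 2
    rwa [mul_pow, sq_abs, sq_abs, hT0, sub_zero, sub_zero] at this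
  have htb : EssBdd t := by
    obtain ⟨C, hC⟩ := hu
    refine ⟨|L| * C, ?_⟩
    filter_upwards [hC, ht] with x h1 h2
    have := hT (u x) 0
    rw [hT0, sub_zero, sub_zero] at this
    rw [h2]
    refine this.trans (mul_le_mul (le_abs_self L) h1 (abs_nonneg _) (abs_nonneg _))
  obtain ⟨u2, hu2⟩ := exists_L2_mul u u hu
  obtain ⟨t2, ht2⟩ := exists_L2_mul t t htb
  obtain ⟨p, hp⟩ := exists_L2_mul u (S u) hu
  obtain ⟨q, hq⟩ := exists_L2_mul t (S t) htb
  have hpt := hS.carre_lipschitz hT hT0 hu ht (u2 := u2) (t2 := t2)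
    (by filter_upwards [hu2] with x h; rw [h]; ring)
    (by filter_upwards [ht2] with x h; rw [h]; ring)
  -- The pointwise contraction is integrated against the indicator, and the killing terms are
  -- compared through the nonnegative weight `L² u² - t²`. The form appears as `k → ∞`.
  have key : ∀ k, 2 * inner ℝ t t - 2 * inner ℝ (spanCut k t) (S t)
      ≤ L ^ 2 * (2 * inner ℝ u u - 2 * inner ℝ (spanCut k u) (S u)) := by
    intro k
    have h1 : inner ℝ (spanOne m k) (S t2 - (2 : ℝ) • q + t2)
        ≤ inner ℝ (L ^ 2 • spanOne m k) (S u2 - (2 : ℝ) • p + u2) := by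
      refine L2_inner_mono ?_
      filter_upwards [hpt, coeFn_carre S u u2 p hp, coeFn_carre S t t2 q hq,
        Lp.coeFn_smul (L ^ 2) (spanOne m k), spanOne_eq (m := m) k] with x h1 h2 h3 h4 h5
      rw [h2, h3, h4, Pi.smul_apply, smul_eq_mul]
      rcases h5 with h5 | h5 <;> rw [h5] <;> linarith
    rw [real_inner_smul_left, hS.inner_carre_eq (spanCut_eq k t) hq,
      hS.inner_carre_eq (spanCut_eq k u) hp] at h1
    have hi1 : Integrable (fun x => L ^ 2 * (u x * u x)) m := (L2_integrable_mul u u).const_mul _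
    have hi2 := L2_integrable_mul t t
    have h2 := hS.integral_le_two_norm_sq k (w := fun x => L ^ 2 * (u x * u x) - t x * t x)
      (hi1.sub hi2) (by
        filter_upwards [ht] with x h
        have := hTsq0 (u x)
        rw [h]; nlinarith)
    rw [integral_sub hi1 hi2, integral_const_mul, ← L2_inner_eq_integral,
      ← L2_inner_eq_integral] at h2
    have h3 : ∀ v : Lp ℝ 2 m, ∫ x, v x * (L ^ 2 * (u x * u x) - t x * t x) ∂m
        = L ^ 2 * inner ℝ v u2 - inner ℝ v t2 := by
      intro v
      rw [L2_inner_eq_integral, L2_inner_eq_integral, ← integral_const_mul,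
        ← integral_sub ((L2_integrable_mul v u2).const_mul _) (L2_integrable_mul v t2)]
      refine integral_congr_ae ?_
      filter_upwards [hu2, ht2] with x h1 h2
      rw [h1, h2]; ring
    rw [h3, h3] at h2
    linarith
  have hlim : ∀ v : Lp ℝ 2 m, Tendsto (fun k => 2 * inner ℝ v v - 2 * inner ℝ (spanCut k v) (S v))
      atTop (𝓝 (2 * inner ℝ v v - 2 * inner ℝ v (S v))) := fun v =>
    (((tendsto_spanCut v).inner tendsto_const_nhds).const_mul 2).const_sub _
  have := le_of_tendsto_of_tendsto' (hlim t) ((hlim u).const_mul (L ^ 2)) key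
  rw [inner_sub_left, inner_sub_left, real_inner_comm t (S t), real_inner_comm u (S u)]
  linarith

-- Symmetry of `S` moves it from `φ` onto `u²`. The approximate energy functional is thus
-- integration of `φ` against the squared gradient, so it inherits positivity from it.
omit [SigmaFinite m] in
lemma inner_approx_eq (hS : IsMarkovOp S) {φ uφ : Lp ℝ 2 m}
    (hu2 : ∀ᵐ x ∂m, u2 x = u x * u x) (hφ : ∀ᵐ x ∂m, uφ x = u x * φ x)
    (hp : ∀ᵐ x ∂m, p x = u x * S u x) :
    2 * inner ℝ (uφ - S uφ) u - inner ℝ (φ - S φ) u2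
      = inner ℝ φ (S u2 - (2 : ℝ) • p + u2) := by
  rw [hS.inner_carre_eq (φu := uφ) (by filter_upwards [hφ] with x h; rw [h]; ring) hp]
  have h1 : inner ℝ uφ u = inner ℝ φ u2 := by
    refine L2_inner_congr ?_
    filter_upwards [hφ, hu2] with x h1 h2
    rw [h1, h2]; ring
  rw [inner_sub_left, inner_sub_left, hS.symm uφ u, h1]; ring

lemma carre_nonneg (hS : IsMarkovOp S) (hu : EssBdd u) (hu2 : ∀ᵐ x ∂m, u2 x = u x * u x)
    (hp : ∀ᵐ x ∂m, p x = u x * S u x) :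
    ∀ᵐ x ∂m, 0 ≤ (S u2 - (2 : ℝ) • p + u2 : Lp ℝ 2 m) x := by
  have h := hS.carre_lipschitz (T := fun _ => 0) (L := 1) (t := 0) (t2 := 0) (u2 := u2)
    (by intro a b; simp) rfl hu
    (by filter_upwards [Lp.coeFn_zero ℝ 2 m] with x h; rw [h]; rfl)
    (by filter_upwards [hu2] with x h; rw [h]; ring)
    (by filter_upwards [Lp.coeFn_zero ℝ 2 m] with x h; rw [h]; norm_num)
  rw [map_zero] at h
  filter_upwards [h, coeFn_carre S u u2 p hp, Lp.coeFn_zero ℝ 2 m] with x h1 h2 h3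
  rw [h2]
  rw [h3] at h1
  simpa using h1

lemma inner_approx_nonneg (hS : IsMarkovOp S) (hu : EssBdd u) {φ uφ : Lp ℝ 2 m}
    (hu2 : ∀ᵐ x ∂m, u2 x = u x * u x) (hφ : ∀ᵐ x ∂m, uφ x = u x * φ x)
    (h0 : ∀ᵐ x ∂m, 0 ≤ φ x) :
    0 ≤ 2 * inner ℝ (uφ - S uφ) u - inner ℝ (φ - S φ) u2 := by
  obtain ⟨p, hp⟩ := exists_L2_mul u (S u) hu
  rw [hS.inner_approx_eq hu2 hφ hp, L2_inner_eq_integral]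
  refine integral_nonneg_of_ae ?_
  filter_upwards [h0, hS.carre_nonneg hu hu2 hp] with x h1 h2 using mul_nonneg h1 h2

/-- The squared gradient is nonnegative, so `φ` may be replaced by the constant `c`; the total
integral of the squared gradient is at most `2⟪u - S u, u⟫`. -/
lemma inner_approx_le (hS : IsMarkovOp S) (hu : EssBdd u) {φ uφ : Lp ℝ 2 m} {c : ℝ} (hc : 0 ≤ c)
    (hu2 : ∀ᵐ x ∂m, u2 x = u x * u x) (hφ : ∀ᵐ x ∂m, uφ x = u x * φ x)
    (h0 : ∀ᵐ x ∂m, φ x ≤ c) :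
    2 * inner ℝ (uφ - S uφ) u - inner ℝ (φ - S φ) u2 ≤ 2 * c * inner ℝ (u - S u) u := by
  obtain ⟨p, hp⟩ := exists_L2_mul u (S u) hu
  rw [hS.inner_approx_eq hu2 hφ hp]
  have key : ∀ k, inner ℝ (spanCut k φ) (S u2 - (2 : ℝ) • p + u2)
      ≤ c * (2 * inner ℝ u u - 2 * inner ℝ (spanCut k u) (S u)) := by
    intro k
    have h1 : inner ℝ (spanCut k φ) (S u2 - (2 : ℝ) • p + u2)
        ≤ inner ℝ (c • spanOne m k) (S u2 - (2 : ℝ) • p + u2) := by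
      refine L2_inner_mono ?_
      filter_upwards [h0, hS.carre_nonneg hu hu2 hp, spanCut_eq k φ, spanOne_eq (m := m) k,
        Lp.coeFn_smul c (spanOne m k)] with x h1 h2 h3 h4 h5
      rw [h3, h5, Pi.smul_apply, smul_eq_mul]
      refine mul_le_mul_of_nonneg_right ?_ h2
      rcases h4 with h4 | h4 <;> rw [h4] <;> simp [h1]
    refine h1.trans ?_
    rw [real_inner_smul_left, hS.inner_carre_eq (spanCut_eq k u) hp]
    refine mul_le_mul_of_nonneg_left ?_ hc
    have h2 := hS.integral_le_two_norm_sq k (w := fun x => u x * u x) (L2_integrable_mul u u)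
      (Eventually.of_forall fun x => mul_self_nonneg _)
    have h3 : ∀ v : Lp ℝ 2 m, ∫ x, v x * (u x * u x) ∂m = inner ℝ v u2 := by
      intro v
      rw [L2_inner_eq_integral]
      refine integral_congr_ae ?_
      filter_upwards [hu2] with x h1
      rw [h1]
    rw [h3, h3, ← L2_inner_eq_integral] at h2
    linarith
  have hlim : Tendsto (fun k => c * (2 * inner ℝ u u - 2 * inner ℝ (spanCut k u) (S u)))
      atTop (𝓝 (c * (2 * inner ℝ u u - 2 * inner ℝ u (S u)))) :=
    ((((tendsto_spanCut u).inner tendsto_const_nhds).const_mul 2).const_sub _).const_mul c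
  have := le_of_tendsto_of_tendsto' ((tendsto_spanCut φ).inner tendsto_const_nhds) hlim key
  rw [inner_sub_left, real_inner_comm u (S u)]
  linarith

end IsMarkovOp

/-! ### The algebra of bounded elements and the energy functional on it. -/

namespace DirichletForm

variable {X : Type*} [MeasurableSpace X] {m : Measure X} (E : DirichletForm m)

lemma isMarkovOp_resSeq (k : ℕ) : IsMarkovOp (E.resSeq k) where
  symm := E.inner_resolventL _ _
  norm_le := E.norm_resolventL_le _ _
  unit_interval _ := E.resolventL_unit_interval _ _

/-- The essentially bounded elements of the domain. -/
def bdd : Submodule ℝ E.domain where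
  carrier := {u | EssBdd u.1}
  add_mem' := by
    rintro u v ⟨C, hC⟩ ⟨D, hD⟩
    refine ⟨C + D, ?_⟩
    filter_upwards [hC, hD, Lp.coeFn_add u.1 v.1] with x h1 h2 h3
    rw [Submodule.coe_add, h3, Pi.add_apply]
    exact (abs_add_le _ _).trans (add_le_add h1 h2)
  zero_mem' := ⟨0, by
    filter_upwards [Lp.coeFn_zero ℝ 2 m] with x h
    rw [Submodule.coe_zero, h]; simp⟩
  smul_mem' := by
    rintro c u ⟨C, hC⟩
    refine ⟨|c| * C, ?_⟩
    filter_upwards [hC, Lp.coeFn_smul c u.1] with x h1 h3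
    rw [Submodule.coe_smul, h3, Pi.smul_apply, smul_eq_mul, abs_mul]
    gcongr

lemma ext_ae {u v : E.domain} (h : ∀ᵐ x ∂m, u.1 x = v.1 x) : u = v := Subtype.ext (Lp.ext h)

section

variable [SigmaFinite m]

/-- Lipschitz functions operate on bounded elements of the domain. -/
lemma exists_lipschitz_comp {T : ℝ → ℝ} {L : ℝ}
    (hT : ∀ a b, |T a - T b| ≤ L * |a - b|) (hT0 : T 0 = 0) {u : E.domain} (hu : u ∈ E.bdd) :
    ∃ t ∈ E.bdd, ∀ᵐ x ∂m, t.1 x = T (u.1 x) := by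
  have hTc : Continuous T := by
    have : LipschitzWith (Real.toNNReal L) T := LipschitzWith.of_dist_le_mul fun a b => by
      rw [Real.dist_eq, Real.dist_eq]
      refine (hT a b).trans (mul_le_mul_of_nonneg_right (Real.le_coe_toNNReal L) (abs_nonneg _))
    exact this.continuous
  have hle : ∀ a, |T a| ≤ L * |a| := fun a => by simpa [hT0] using hT a 0
  obtain ⟨t, ht⟩ := exists_L2_of_abs_le (f := fun x => T (u.1 x)) (C := L)
    (hTc.comp_aestronglyMeasurable (Lp.aestronglyMeasurable u.1)) u.1
    (Eventually.of_forall fun x => hle _)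
  -- Membership in the domain is tested on the approximating forms, where the Lipschitz contraction
  -- is already known.
  obtain ⟨f, hf, -, -⟩ := E.exists_domain_of_bounded (u := t) (C := L ^ 2 * E.form u u)
    fun k => by
      have h1 := (E.isMarkovOp_resSeq k).inner_lipschitz_le hT hT0 hu ht
      have h2 := E.inner_sub_resolventL_self_le ((k : ℝ) + 1) (by positivity) u
      have h3 := mul_le_mul_of_nonneg_left h1 (show (0:ℝ) ≤ (k : ℝ) + 1 by positivity)
      have h4 := mul_le_mul_of_nonneg_left h2 (sq_nonneg L)
      linarith
  refine ⟨f, ?_, by rw [hf]; exact ht⟩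
  obtain ⟨C, hC⟩ := hu
  refine ⟨|L| * C, ?_⟩
  rw [hf]
  filter_upwards [hC, ht] with x h1 h2
  rw [h2]
  exact (hle _).trans (mul_le_mul (le_abs_self L) h1 (abs_nonneg _) (abs_nonneg _))

/-- Squaring is not globally Lipschitz; clamping to `[-D, D]` first makes it `2D`-Lipschitz and
changes nothing on the essential range of `u`. -/
lemma exists_sq {u : E.domain} (hu : u ∈ E.bdd) :
    ∃ t ∈ E.bdd, ∀ᵐ x ∂m, t.1 x = u.1 x * u.1 x := by
  obtain ⟨C, hC⟩ := hu
  set D := |C| with hD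
  have hD0 : 0 ≤ D := abs_nonneg C
  obtain ⟨t, ht, h⟩ := E.exists_lipschitz_comp (T := fun a => max (-D) (min D a) ^ 2) (L := 2 * D)
    (by
      intro a b
      have h1 : ∀ a, |max (-D) (min D a)| ≤ D := fun a =>
        abs_le.2 ⟨le_max_left _ _, max_le (by linarith) (min_le_left _ _)⟩
      have h2 : |max (-D) (min D a) - max (-D) (min D b)| ≤ |a - b| :=
        (abs_max_sub_max_le_max _ _ _ _).trans (by
          rw [sub_self, abs_zero]
          refine max_le (abs_nonneg _) ((abs_min_sub_min_le_max _ _ _ _).trans ?_)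
          rw [sub_self, abs_zero]
          exact max_le (abs_nonneg _) le_rfl)
      rw [sq_sub_sq, abs_mul]
      refine mul_le_mul ((abs_add_le _ _).trans ?_) h2 (abs_nonneg _) (by positivity)
      linarith [h1 a, h1 b])
    (by simp [hD0]) (u := u) ⟨C, hC⟩
  refine ⟨t, ht, ?_⟩
  filter_upwards [h, hC] with x h1 h2
  have h3 := abs_le.1 (h2.trans (le_abs_self C))
  rw [h1, min_eq_right h3.2, max_eq_right h3.1]; ring

lemma exists_mul (u v : E.bdd) : ∃ w : E.bdd, ∀ᵐ x ∂m, w.1.1 x = u.1.1 x * v.1.1 x := by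
  obtain ⟨s, hs, h1⟩ := E.exists_sq (u + v).2
  obtain ⟨t, ht, h2⟩ := E.exists_sq (u - v).2
  refine ⟨(1 / 4 : ℝ) • (⟨s, hs⟩ - ⟨t, ht⟩), ?_⟩
  filter_upwards [h1, h2, Lp.coeFn_smul (1 / 4 : ℝ) (s.1 - t.1), Lp.coeFn_sub s.1 t.1,
    Lp.coeFn_add u.1.1 v.1.1, Lp.coeFn_sub u.1.1 v.1.1] with x h1 h2 h3 h4 h5 h6
  simp only [Submodule.coe_smul, Submodule.coe_sub, Submodule.coe_add] at *
  rw [h3, Pi.smul_apply, h4, Pi.sub_apply, h1, h2, h5, h6, Pi.add_apply, Pi.sub_apply, smul_eq_mul]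
  ring

/-- Multiplication of bounded elements of the domain. -/
noncomputable def mulB : E.bdd →ₗ[ℝ] E.bdd →ₗ[ℝ] E.bdd :=
  LinearMap.mk₂ ℝ (fun u v => (E.exists_mul u v).choose)
    (fun u u' v => Subtype.ext (E.ext_ae (by
      filter_upwards [(E.exists_mul (u + u') v).choose_spec, (E.exists_mul u v).choose_spec,
        (E.exists_mul u' v).choose_spec, Lp.coeFn_add u.1.1 u'.1.1,
        Lp.coeFn_add (E.exists_mul u v).choose.1.1 (E.exists_mul u' v).choose.1.1]
        with x h1 h2 h3 h4 h5
      simp only [Submodule.coe_add] at *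
      rw [h1, h4, h5, Pi.add_apply, Pi.add_apply, h2, h3]; ring)))
    (fun c u v => Subtype.ext (E.ext_ae (by
      filter_upwards [(E.exists_mul (c • u) v).choose_spec, (E.exists_mul u v).choose_spec,
        Lp.coeFn_smul c u.1.1, Lp.coeFn_smul c (E.exists_mul u v).choose.1.1]
        with x h1 h2 h4 h5
      simp only [Submodule.coe_smul] at *
      rw [h1, h4, h5, Pi.smul_apply, Pi.smul_apply, h2, smul_eq_mul, smul_eq_mul]; ring)))
    (fun u v v' => Subtype.ext (E.ext_ae (by
      filter_upwards [(E.exists_mul u (v + v')).choose_spec, (E.exists_mul u v).choose_spec,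
        (E.exists_mul u v').choose_spec, Lp.coeFn_add v.1.1 v'.1.1,
        Lp.coeFn_add (E.exists_mul u v).choose.1.1 (E.exists_mul u v').choose.1.1]
        with x h1 h2 h3 h4 h5
      simp only [Submodule.coe_add] at *
      rw [h1, h4, h5, Pi.add_apply, Pi.add_apply, h2, h3]; ring)))
    (fun c u v => Subtype.ext (E.ext_ae (by
      filter_upwards [(E.exists_mul u (c • v)).choose_spec, (E.exists_mul u v).choose_spec,
        Lp.coeFn_smul c v.1.1, Lp.coeFn_smul c (E.exists_mul u v).choose.1.1]
        with x h1 h2 h4 h5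
      simp only [Submodule.coe_smul] at *
      rw [h1, h4, h5, Pi.smul_apply, Pi.smul_apply, h2, smul_eq_mul, smul_eq_mul]; ring)))

lemma mulB_ae (u v : E.bdd) : ∀ᵐ x ∂m, (E.mulB u v).1.1 x = u.1.1 x * v.1.1 x :=
  (E.exists_mul u v).choose_spec

/-- The functional `E(uφ, v) + E(vφ, u) - E(φ, uv)`. -/
noncomputable def gamma (φ u v : E.bdd) : ℝ :=
  E.form (E.mulB u φ).1 v.1 + E.form (E.mulB v φ).1 u.1 - E.form φ.1 (E.mulB u v).1

lemma gamma_self (φ u : E.bdd) :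
    E.gamma φ u u = 2 * E.form (E.mulB u φ).1 u.1 - E.form φ.1 (E.mulB u u).1 := by
  rw [gamma]; ring

lemma gamma_add_left (φ ψ u v : E.bdd) : E.gamma (φ + ψ) u v = E.gamma φ u v + E.gamma ψ u v := by
  simp only [gamma, map_add, LinearMap.add_apply, Submodule.coe_add]; ring

lemma gamma_smul_left (c : ℝ) (φ u v : E.bdd) : E.gamma (c • φ) u v = c * E.gamma φ u v := by
  simp only [gamma, map_smul, LinearMap.smul_apply, Submodule.coe_smul, smul_eq_mul]; ring

lemma gamma_add_middle (φ u u' v : E.bdd) :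
    E.gamma φ (u + u') v = E.gamma φ u v + E.gamma φ u' v := by
  simp only [gamma, map_add, LinearMap.add_apply, Submodule.coe_add]; ring

lemma gamma_smul_middle (c : ℝ) (φ u v : E.bdd) : E.gamma φ (c • u) v = c * E.gamma φ u v := by
  simp only [gamma, map_smul, LinearMap.smul_apply, Submodule.coe_smul, smul_eq_mul]; ring

lemma gamma_symm (φ u v : E.bdd) : E.gamma φ u v = E.gamma φ v u := by
  have : E.mulB u v = E.mulB v u := Subtype.ext (E.ext_ae (by
    filter_upwards [E.mulB_ae u v, E.mulB_ae v u] with x h1 h2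
    rw [h1, h2, mul_comm]))
  rw [gamma, gamma, this]; ring

lemma gamma_add_right (φ u v v' : E.bdd) :
    E.gamma φ u (v + v') = E.gamma φ u v + E.gamma φ u v' := by
  rw [gamma_symm, gamma_add_middle, gamma_symm, E.gamma_symm φ v' u]

lemma gamma_smul_right (c : ℝ) (φ u v : E.bdd) : E.gamma φ u (c • v) = c * E.gamma φ u v := by
  rw [gamma_symm, gamma_smul_middle, gamma_symm]

lemma tendsto_gamma (φ u : E.bdd) :
    Tendsto (fun k : ℕ => ((k : ℝ) + 1) *
      (2 * inner ℝ ((E.mulB u φ).1.1 - E.resSeq k (E.mulB u φ).1.1) u.1.1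
        - inner ℝ (φ.1.1 - E.resSeq k φ.1.1) (E.mulB u u).1.1)) atTop (𝓝 (E.gamma φ u u)) := by
  rw [gamma_self]
  refine (((E.tendsto_inner_sub_resSeq (E.mulB u φ).1 u.1).const_mul 2).sub
    (E.tendsto_inner_sub_resSeq φ.1 (E.mulB u u).1)).congr fun k => ?_
  ring

/-- The approximating functionals are nonnegative for every resolvent, and `E.gamma φ u u` is their
limit. -/
lemma gamma_nonneg {φ : E.bdd} (hφ : ∀ᵐ x ∂m, 0 ≤ φ.1.1 x) (u : E.bdd) : 0 ≤ E.gamma φ u u :=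
  ge_of_tendsto' (E.tendsto_gamma φ u) fun k => mul_nonneg (by positivity)
    ((E.isMarkovOp_resSeq k).inner_approx_nonneg u.2 (E.mulB_ae u u) (E.mulB_ae u φ) hφ)

lemma gamma_le {φ : E.bdd} {c : ℝ} (hc : 0 ≤ c) (hφ : ∀ᵐ x ∂m, φ.1.1 x ≤ c) (u : E.bdd) :
    E.gamma φ u u ≤ 2 * c * E.form u.1 u.1 := by
  refine le_of_tendsto' (E.tendsto_gamma φ u) fun k => ?_
  have h1 := (E.isMarkovOp_resSeq k).inner_approx_le u.2 hc (E.mulB_ae u u) (E.mulB_ae u φ) hφ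
  have h2 := E.inner_sub_resolventL_self_le ((k : ℝ) + 1) (by positivity) u.1
  have h3 := mul_le_mul_of_nonneg_left h1 (show (0:ℝ) ≤ (k : ℝ) + 1 by positivity)
  have h4 := mul_le_mul_of_nonneg_left h2 (show 0 ≤ 2 * c by positivity)
  refine h3.trans (le_trans (le_of_eq ?_) h4)
  ring

lemma abs_gamma_le {φ : E.bdd} {c : ℝ} (hc : 0 ≤ c) (hφ : ∀ᵐ x ∂m, |φ.1.1 x| ≤ c) (u : E.bdd) :
    |E.gamma φ u u| ≤ c * (2 * E.form u.1 u.1) := by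
  have h1 := E.gamma_le hc (φ := φ) (by filter_upwards [hφ] with x h using (abs_le.1 h).2) u
  have h2 := E.gamma_le hc (φ := -φ) (by
    filter_upwards [hφ, Lp.coeFn_neg φ.1.1] with x h h'
    rw [Submodule.coe_neg, Submodule.coe_neg, h', Pi.neg_apply]
    linarith [(abs_le.1 h).1]) u
  rw [← neg_one_smul ℝ, gamma_smul_left] at h2
  exact abs_le.2 ⟨by linarith, by linarith⟩

end

/-! ### Riesz representation of the energy functional. -/

section CompactSupport

variable {X : Type*} [TopologicalSpace X] [SecondCountableTopology X]
  [LocallyCompactSpace X] [TopologicalSpace.MetrizableSpace X] [MeasurableSpace X] [BorelSpace X]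
  {m : Measure X} (E : DirichletForm m)

omit [SecondCountableTopology X] [LocallyCompactSpace X] [TopologicalSpace.MetrizableSpace X]
  [MeasurableSpace X] [BorelSpace X] in
lemma exists_abs_le_of_compactlySupported (φ : C_c(X, ℝ)) : ∃ C : ℝ, 0 ≤ C ∧ ∀ x, |φ x| ≤ C := by
  refine ⟨‖φ.toBoundedContinuousFunction‖, norm_nonneg _, fun x => ?_⟩
  exact φ.toBoundedContinuousFunction.norm_coe_le_norm x

omit [SecondCountableTopology X] [LocallyCompactSpace X] [TopologicalSpace.MetrizableSpace X]
  [BorelSpace X] in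
lemma mem_bdd_of_ae_eq {u : E.domain} {φ : C_c(X, ℝ)} (h : u.1 =ᵐ[m] φ) : u ∈ E.bdd := by
  obtain ⟨C, -, hC⟩ := exists_abs_le_of_compactlySupported φ
  refine ⟨C, ?_⟩
  filter_upwards [h] with x hx
  rw [hx]; exact hC x

omit [TopologicalSpace.MetrizableSpace X] [BorelSpace X] in
lemma exists_lipschitz_comp_compactlySupported [m.Regular] {T : ℝ → ℝ} {L : ℝ}
    (hT : ∀ a b, |T a - T b| ≤ L * |a - b|) (hT0 : T 0 = 0) {u : E.domain} {φ : C_c(X, ℝ)}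
    (h : u.1 =ᵐ[m] φ) :
    ∃ (ψ : C_c(X, ℝ)) (v : E.bdd), (∀ x, ψ x = T (φ x)) ∧ v.1.1 =ᵐ[m] ψ := by
  have hTc : Continuous T := by
    have : LipschitzWith (Real.toNNReal L) T := LipschitzWith.of_dist_le_mul fun a b => by
      rw [Real.dist_eq, Real.dist_eq]
      refine (hT a b).trans (mul_le_mul_of_nonneg_right (Real.le_coe_toNNReal L) (abs_nonneg _))
    exact this.continuous
  obtain ⟨v, hv, hv'⟩ := E.exists_lipschitz_comp hT hT0 (E.mem_bdd_of_ae_eq h)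
  have hψ : ∀ x, φ.compLeft ⟨T, hTc⟩ x = T (φ x) :=
    fun x => CompactlySupportedContinuousMap.compLeft_apply (g := ⟨T, hTc⟩) hT0 φ x
  refine ⟨φ.compLeft ⟨T, hTc⟩, ⟨v, hv⟩, hψ, ?_⟩
  filter_upwards [hv', h] with x h1 h2
  rw [h1, h2, hψ]

omit [TopologicalSpace.MetrizableSpace X] [BorelSpace X] in
/-- The uniformly continuous functional extends from `F ∩ C_c(X)` to `C_c(X)`. -/
lemma exists_energy_functional [m.Regular] (hreg : E.IsRegular) (u : E.bdd) :
    ∃ Λ : C_c(X, ℝ) →ₚ[ℝ] ℝ,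
      (∀ (φ : C_c(X, ℝ)) (v : E.bdd), v.1.1 =ᵐ[m] φ → Λ φ = E.gamma v u u) ∧
      ∀ (φ : C_c(X, ℝ)) (C : ℝ), 0 ≤ C → (∀ x, |φ x| ≤ C) → |Λ φ| ≤ C * (2 * E.form u.1 u.1) := by
  set D : Submodule ℝ (BoundedContinuousFunction X ℝ) :=
    { carrier := {ψ | ∃ v : E.bdd, v.1.1 =ᵐ[m] ψ}
      add_mem' := by
        rintro ψ ψ' ⟨v, hv⟩ ⟨v', hv'⟩
        refine ⟨v + v', ?_⟩
        filter_upwards [hv, hv', Lp.coeFn_add v.1.1 v'.1.1] with x h1 h2 h3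
        simp only [Submodule.coe_add] at *
        rw [h3, Pi.add_apply, h1, h2]; rfl
      zero_mem' := ⟨0, by
        filter_upwards [Lp.coeFn_zero ℝ 2 m] with x h
        simp only [Submodule.coe_zero]
        rw [h]; rfl⟩
      smul_mem' := by
        rintro c ψ ⟨v, hv⟩
        refine ⟨c • v, ?_⟩
        filter_upwards [hv, Lp.coeFn_smul c v.1.1] with x h1 h3
        simp only [Submodule.coe_smul] at *
        rw [h3, Pi.smul_apply, h1]; rfl } with hD
  choose lift hlift using fun ψ : D => ψ.2
  have hliftu : ∀ (ψ : D) (v : E.bdd), v.1.1 =ᵐ[m] ψ.1 → v = lift ψ := fun ψ v hv =>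
    Subtype.ext (E.ext_ae (by filter_upwards [hv, hlift ψ] with x h1 h2; rw [h1, h2]))
  set ℓ : D →ₗ[ℝ] ℝ :=
    { toFun := fun ψ => E.gamma (lift ψ) u u
      map_add' := fun ψ ψ' => by
        rw [← gamma_add_left]
        congr 1
        refine (hliftu _ _ ?_).symm
        filter_upwards [hlift ψ, hlift ψ', Lp.coeFn_add (lift ψ).1.1 (lift ψ').1.1] with x h1 h2 h3
        simp only [Submodule.coe_add] at *
        rw [h3, Pi.add_apply, h1, h2]; rfl
      map_smul' := fun c ψ => by
        rw [RingHom.id_apply, smul_eq_mul, ← gamma_smul_left]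
        congr 1
        refine (hliftu _ _ ?_).symm
        filter_upwards [hlift ψ, Lp.coeFn_smul c (lift ψ).1.1] with x h1 h3
        simp only [Submodule.coe_smul] at *
        rw [h3, Pi.smul_apply, h1]; rfl } with hℓ
  have hbound : ∀ ψ : D, ‖ℓ ψ‖ ≤ (2 * E.form u.1 u.1) * ‖ψ‖ := fun ψ => by
    rw [mul_comm, Real.norm_eq_abs]
    refine E.abs_gamma_le (c := ‖ψ‖) (norm_nonneg ψ) ?_ u
    filter_upwards [hlift ψ] with x h
    rw [h]; exact BoundedContinuousFunction.norm_coe_le_norm ψ.1 x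
  have hE0 : 0 ≤ 2 * E.form u.1 u.1 := mul_nonneg zero_le_two (E.nonneg _)
  -- Hahn–Banach gives a norm-preserving extension to all bounded continuous functions; only its
  -- restriction to `C_c(X)` is kept.
  obtain ⟨g, hg, hgn⟩ := exists_extension_norm_eq D (ℓ.mkContinuous _ hbound)
  have hgn' : ‖g‖ ≤ 2 * E.form u.1 u.1 := by
    rw [hgn]; exact LinearMap.mkContinuous_norm_le _ hE0 _
  have hgE : ∀ (φ : C_c(X, ℝ)) (v : E.bdd), v.1.1 =ᵐ[m] φ →
      g φ.toBoundedContinuousFunction = E.gamma v u u := fun φ v hv => by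
    have h1 := hg ⟨φ.toBoundedContinuousFunction, v, hv⟩
    have h2 := hliftu ⟨φ.toBoundedContinuousFunction, v, hv⟩ v hv
    rw [h2]
    exact h1
  have hgb : ∀ (φ : BoundedContinuousFunction X ℝ) (C : ℝ), 0 ≤ C → (∀ x, |φ x| ≤ C) →
      |g φ| ≤ C * (2 * E.form u.1 u.1) := fun φ C hC h => by
    have h1 : ‖φ‖ ≤ C := (BoundedContinuousFunction.norm_le hC).2 h
    calc |g φ| ≤ ‖g‖ * ‖φ‖ := g.le_opNorm φ
      _ ≤ (2 * E.form u.1 u.1) * C := by gcongr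
      _ = _ := mul_comm _ _
  refine ⟨PositiveLinearMap.mk₀
    { toFun := fun φ => g φ.toBoundedContinuousFunction
      map_add' := fun φ ψ => by rw [← map_add]; rfl
      map_smul' := fun c φ => by rw [RingHom.id_apply, ← map_smul]; rfl } ?_, hgE,
      fun φ C hC h => hgb _ C hC h⟩
  intro ψ hψ
  change 0 ≤ g ψ.toBoundedContinuousFunction
  -- Positivity is not part of Hahn–Banach. A nonnegative `ψ` is uniformly approximated by positive
  -- parts of elements of `F ∩ C_c(X)`, on which the functional is nonnegative.
  have key : ∀ ε > 0, -(ε * (2 * E.form u.1 u.1)) ≤ g ψ.toBoundedContinuousFunction := by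
    intro ε hε
    obtain ⟨φ, w, hw, hφ⟩ := hreg.dense_in_continuous ψ ε hε
    obtain ⟨φ', v, h1, h2⟩ := E.exists_lipschitz_comp_compactlySupported (L := 1)
      (T := fun a => max a 0)
      (fun a b => by simpa using abs_max_sub_max_le_abs a b 0) (by simp) hw
    have h3 := hgb (ψ.toBoundedContinuousFunction - φ'.toBoundedContinuousFunction) ε hε.le
      (fun x => by
        have h4 : (0 : ℝ) ≤ ψ x := hψ x
        have h5 := abs_max_sub_max_le_abs (ψ x) (φ x) 0
        rw [max_eq_left h4] at h5
        change |ψ x - φ' x| ≤ ε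
        rw [h1]
        exact h5.trans (hφ x).le)
    rw [map_sub, hgE φ' v h2] at h3
    have h4 : 0 ≤ E.gamma v u u := E.gamma_nonneg (by
      filter_upwards [h2] with x hx
      rw [hx, h1]; exact le_max_right _ _) u
    linarith [(abs_le.1 h3).1]
  by_contra hc
  push Not at hc
  set a := g ψ.toBoundedContinuousFunction
  -- The `+ 1` keeps the denominator positive when the energy of `u` is zero.
  have h1 := key (-a / (2 * (2 * E.form u.1 u.1 + 1))) (div_pos (by linarith) (by linarith))
  have h2 : -a / (2 * (2 * E.form u.1 u.1 + 1)) * (2 * E.form u.1 u.1) ≤ -a / 2 := by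
    rw [div_mul_eq_mul_div, div_le_div_iff₀ (by linarith) (by norm_num)]
    nlinarith
  linarith

/-- Existence of the energy measure of a bounded element. -/
lemma exists_bddEnergy [m.Regular] (hreg : E.IsRegular) (u : E.bdd) :
    ∃ μ : FiniteMeasure X,
      (∀ (φ : C_c(X, ℝ)) (v : E.bdd), v.1.1 =ᵐ[m] φ →
        ∫ x, φ x ∂(μ : Measure X) = E.gamma v u u) ∧
      (μ : Measure X).real Set.univ ≤ 2 * E.form u.1 u.1 := by
  obtain ⟨Λ, h1, h2⟩ := E.exists_energy_functional hreg u
  have hE0 : 0 ≤ 2 * E.form u.1 u.1 := mul_nonneg zero_le_two (E.nonneg _)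
  -- By inner regularity it suffices to bound compact sets, each tested with a function with values
  -- in `[0,1]` that equals `1` there.
  have hmass : RealRMK.rieszMeasure Λ Set.univ ≤ ENNReal.ofReal (2 * E.form u.1 u.1) := by
    rw [isOpen_univ.measure_eq_iSup_isCompact]
    refine iSup_le fun K => iSup_le fun _ => iSup_le fun hK => ?_
    obtain ⟨f, hf1, hf2, -, hf3⟩ := exists_continuousMap_one_of_isCompact_subset_isOpen hK
      isOpen_univ (Set.subset_univ K)
    refine (RealRMK.rieszMeasure_le_of_eq_one Λ (f := ⟨f, hf2⟩) (fun x => (hf3 x).1) hK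
      (fun x hx => hf1 hx)).trans (ENNReal.ofReal_le_ofReal ?_)
    have := h2 ⟨f, hf2⟩ 1 zero_le_one (fun x => abs_le.2 ⟨by
      have : 0 ≤ f x := (hf3 x).1
      change -1 ≤ f x
      linarith, (hf3 x).2⟩)
    rw [one_mul] at this
    exact (le_abs_self _).trans this
  have : IsFiniteMeasure (RealRMK.rieszMeasure Λ) := ⟨hmass.trans_lt ENNReal.ofReal_lt_top⟩
  refine ⟨⟨RealRMK.rieszMeasure Λ, this⟩, fun φ v hv => ?_, ?_⟩
  · rw [← h1 φ v hv, ← RealRMK.integral_rieszMeasure]; rfl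
  · exact ENNReal.toReal_le_of_le_ofReal hE0 hmass

/-- Finite measures are determined linearly by their integrals over `F ∩ C_c(X)`. -/
lemma sum_measureReal_eq_zero (hreg : E.IsRegular) {ι : Type*} [Fintype ι] (c : ι → ℝ)
    (μ : ι → FiniteMeasure X)
    (h : ∀ (φ : C_c(X, ℝ)) (u : E.domain), u.1 =ᵐ[m] φ →
      ∑ i, c i * ∫ x, φ x ∂(μ i : Measure X) = 0) (B : Set X) :
    ∑ i, c i * (μ i : Measure X).real B = 0 := by
  have hint : ∀ (φ : C_c(X, ℝ)) i, Integrable φ (μ i : Measure X) := fun φ i =>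
    φ.continuous.integrable_of_hasCompactSupport φ.hasCompactSupport
  have hall : ∀ ψ : C_c(X, ℝ), ∑ i, c i * ∫ x, ψ x ∂(μ i : Measure X) = 0 := by
    intro ψ
    set M := ∑ i, |c i| * (μ i : Measure X).real Set.univ with hM
    have hM0 : 0 ≤ M := Finset.sum_nonneg fun i _ => mul_nonneg (abs_nonneg _) measureReal_nonneg
    have key : ∀ ε > 0, |∑ i, c i * ∫ x, ψ x ∂(μ i : Measure X)| ≤ ε * M := by
      intro ε hε
      obtain ⟨φ, u, hu, hφ⟩ := hreg.dense_in_continuous ψ ε hε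
      rw [← sub_zero (∑ i, c i * ∫ x, ψ x ∂(μ i : Measure X)), ← h φ u hu,
        ← Finset.sum_sub_distrib]
      refine (Finset.abs_sum_le_sum_abs _ _).trans ?_
      rw [hM, Finset.mul_sum]
      refine Finset.sum_le_sum fun i _ => ?_
      rw [← mul_sub, abs_mul, ← integral_sub (hint ψ i) (hint φ i), mul_left_comm]
      refine mul_le_mul_of_nonneg_left ?_ (abs_nonneg _)
      exact norm_integral_le_of_norm_le_const (f := fun x => ψ x - φ x) (μ := (μ i : Measure X))
        (Eventually.of_forall fun x => (hφ x).le)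
    by_contra hc
    have h1 := abs_pos.2 hc
    have h2 := key (|∑ i, c i * ∫ x, ψ x ∂(μ i : Measure X)| / (2 * (M + 1))) (by positivity)
    rw [div_mul_eq_mul_div, le_div_iff₀ (by positivity)] at h2
    nlinarith
  -- The signed relation is split by the sign of the coefficients into an equality of two finite
  -- positive measures, which `C_c(X)` determines.
  set P : Measure X := ∑ i, (c i).toNNReal • (μ i : Measure X) with hP
  set N : Measure X := ∑ i, (-c i).toNNReal • (μ i : Measure X) with hN
  have hreal : ∀ d : ι → NNReal, (∑ i, d i • (μ i : Measure X)).real B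
      = ∑ i, (d i : ℝ) * (μ i : Measure X).real B := fun d => by
    rw [Measure.real, Measure.finsetSum_apply, ENNReal.toReal_sum (fun i _ => measure_ne_top (d i • (μ i : Measure X)) B)]
    refine Finset.sum_congr rfl fun i _ => ?_
    rw [Measure.smul_apply, ENNReal.toReal_smul]
    rfl
  have hintg : ∀ (d : ι → NNReal) (ψ : C_c(X, ℝ)), ∫ x, ψ x ∂(∑ i, d i • (μ i : Measure X))
      = ∑ i, (d i : ℝ) * ∫ x, ψ x ∂(μ i : Measure X) := fun d ψ => by
    rw [integral_finsetSum_measure (fun i _ => (hint ψ i).smul_measure_nnreal)]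
    simp [integral_smul_nnreal_measure, NNReal.smul_def]
  have hPN : P = N := by
    refine Measure.ext_of_integral_eq_on_compactlySupported fun ψ => ?_
    rw [hP, hN, hintg, hintg, ← sub_eq_zero, ← Finset.sum_sub_distrib, ← hall ψ]
    refine Finset.sum_congr rfl fun i _ => ?_
    rw [← sub_mul, Real.coe_toNNReal', Real.coe_toNNReal', max_zero_sub_max_neg_zero_eq_self]
  have := congrArg (fun μ : Measure X => μ.real B) hPN
  simp only [hP, hN, hreal] at this
  rw [← sub_eq_zero, ← Finset.sum_sub_distrib] at this
  rw [← this]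
  refine Finset.sum_congr rfl fun i _ => ?_
  rw [← sub_mul, Real.coe_toNNReal', Real.coe_toNNReal', max_zero_sub_max_neg_zero_eq_self]

lemma finiteMeasure_ext (hreg : E.IsRegular) {μ μ' : FiniteMeasure X}
    (h : ∀ (φ : C_c(X, ℝ)) (u : E.domain), u.1 =ᵐ[m] φ →
      ∫ x, φ x ∂(μ : Measure X) = ∫ x, φ x ∂(μ' : Measure X)) : μ = μ' := by
  refine FiniteMeasure.toMeasure_injective (Measure.ext fun B _ => ?_)
  have h1 := E.sum_measureReal_eq_zero hreg ![1, -1] ![μ, μ'] (fun φ u hu => by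
    simp [h φ u hu]) B
  simp only [Fin.sum_univ_two, Matrix.cons_val_zero, Matrix.cons_val_one] at h1
  have h2 : (μ : Measure X).real B = (μ' : Measure X).real B := by linarith
  exact (ENNReal.toReal_eq_toReal_iff' (measure_ne_top _ _) (measure_ne_top _ _)).1 h2

end CompactSupport

end DirichletForm

/-! ### Setwise limits, quadratic forms, and energy measures on the whole domain. -/

/-- Setwise limits of uniformly Cauchy sequences of finite measures. -/
lemma exists_setwise_limit {X : Type*} [MeasurableSpace X] (μ : ℕ → FiniteMeasure X)
    (h : ∀ ε > 0, ∃ N, ∀ j ≥ N, ∀ k ≥ N, ∀ B, MeasurableSet B →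
      |(μ j : Measure X).real B - (μ k : Measure X).real B| ≤ ε) :
    ∃ μ' : FiniteMeasure X, ∀ B, MeasurableSet B →
      Tendsto (fun k => (μ k : Measure X).real B) atTop (𝓝 ((μ' : Measure X).real B)) := by
  have hlim : ∀ B, ∃ l : ℝ, MeasurableSet B →
      Tendsto (fun k => (μ k : Measure X).real B) atTop (𝓝 l) := by
    intro B
    by_cases hB : MeasurableSet B
    · have hc : CauchySeq (fun k => (μ k : Measure X).real B) := by
        rw [Metric.cauchySeq_iff]
        intro ε hε
        obtain ⟨N, hN⟩ := h (ε / 2) (by positivity)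
        exact ⟨N, fun j hj k hk => (hN j hj k hk B hB).trans_lt (by linarith)⟩
      obtain ⟨l, hl⟩ := cauchySeq_tendsto_of_complete hc
      exact ⟨l, fun _ => hl⟩
    · exact ⟨0, fun h => absurd h hB⟩
  choose l hl using hlim
  have hl0 : ∀ B, MeasurableSet B → 0 ≤ l B := fun B hB =>
    ge_of_tendsto' (hl B hB) fun k => measureReal_nonneg
  -- Uniformity in the set is what permits exchanging the limit with countable unions: the limit
  -- inherits countable additivity from a single nearby measure.
  have hunif : ∀ ε > 0, ∃ N, ∀ B, MeasurableSet B → |(μ N : Measure X).real B - l B| ≤ ε := by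
    intro ε hε
    obtain ⟨N, hN⟩ := h ε hε
    refine ⟨N, fun B hB => le_of_tendsto ((hl B hB).const_sub _).abs ?_⟩
    filter_upwards [eventually_ge_atTop N] with k hk using hN N le_rfl k hk B hB
  have hfin : ∀ (f : ℕ → Set X), (∀ i, MeasurableSet (f i)) → Pairwise (Function.onFun Disjoint f) →
      ∀ s : Finset ℕ, ∑ i ∈ s, l (f i) = l (⋃ i ∈ s, f i) := by
    intro f hf hd s
    have h1 := tendsto_finsetSum s fun i (_ : i ∈ s) => hl (f i) (hf i)
    have h2 := hl (⋃ i ∈ s, f i) (s.measurableSet_biUnion fun i _ => hf i)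
    refine tendsto_nhds_unique h1 (h2.congr fun k => ?_)
    exact measureReal_biUnion_finset (fun i _ j _ hij => hd hij) (fun i _ => hf i)
  have hsum : ∀ (f : ℕ → Set X), (∀ i, MeasurableSet (f i)) →
      Pairwise (Function.onFun Disjoint f) → HasSum (fun i => l (f i)) (l (⋃ i, f i)) := by
    intro f hf hd
    rw [HasSum, SummationFilter.unconditional_filter, Metric.tendsto_nhds]
    intro ε hε
    obtain ⟨N, hN⟩ := hunif (ε / 4) (by positivity)
    have h1 : HasSum (fun i => (μ N : Measure X).real (f i)) ((μ N : Measure X).real (⋃ i, f i)) := by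
      have := VectorMeasure.m_iUnion (μ N : Measure X).toSignedMeasure hf hd
      simpa only [Measure.toSignedMeasure_apply_measurable (hf _),
        Measure.toSignedMeasure_apply_measurable (MeasurableSet.iUnion hf)] using this
    rw [HasSum, SummationFilter.unconditional_filter, Metric.tendsto_nhds] at h1
    filter_upwards [h1 (ε / 4) (by positivity)] with s hs
    rw [hfin f hf hd s, Real.dist_eq]
    rw [← measureReal_biUnion_finset (fun i _ j _ hij => hd hij) (fun i _ => hf i),
      Real.dist_eq] at hs
    have h2 := abs_le.1 (hN (⋃ i ∈ s, f i) (s.measurableSet_biUnion fun i _ => hf i))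
    have h3 := abs_le.1 (hN (⋃ i, f i) (MeasurableSet.iUnion hf))
    have h4 := abs_lt.1 hs
    exact abs_lt.2 ⟨by linarith, by linarith⟩
  set P : Measure X := Measure.ofMeasurable (fun B _ => ENNReal.ofReal (l B))
    (by
      have := hl ∅ MeasurableSet.empty
      simp only [measureReal_empty] at this
      rw [tendsto_nhds_unique this tendsto_const_nhds, ENNReal.ofReal_zero])
    (fun f hf hd => by
      have h1 := hsum f hf hd
      rw [← h1.tsum_eq, ENNReal.ofReal_tsum_of_nonneg (fun i => hl0 _ (hf i)) h1.summable]) with hP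
  have hPB : ∀ B, MeasurableSet B → P B = ENNReal.ofReal (l B) := fun B hB =>
    Measure.ofMeasurable_apply B hB
  have : IsFiniteMeasure P := ⟨by rw [hPB _ MeasurableSet.univ]; exact ENNReal.ofReal_lt_top⟩
  refine ⟨⟨P, this⟩, fun B hB => ?_⟩
  have h1 : ((⟨P, this⟩ : FiniteMeasure X) : Measure X).real B = l B := by
    change (P B).toReal = l B
    rw [hPB B hB, ENNReal.toReal_ofReal (hl0 B hB)]
  exact h1 ▸ hl B hB

namespace DirichletForm

section BoundedEnergy

variable {X : Type*} [TopologicalSpace X] [SecondCountableTopology X]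
  [LocallyCompactSpace X] [TopologicalSpace.MetrizableSpace X] [MeasurableSpace X] [BorelSpace X]
  {m : Measure X} [m.Regular] (E : DirichletForm m) (hreg : E.IsRegular)

/-- The energy measure of a bounded element. -/
noncomputable def bddEnergy (u : E.bdd) : FiniteMeasure X := (E.exists_bddEnergy hreg u).choose

lemma integral_bddEnergy (u : E.bdd) {φ : C_c(X, ℝ)} {v : E.domain} (hv : v.1 =ᵐ[m] φ) :
    ∫ x, φ x ∂(E.bddEnergy hreg u : Measure X) = E.gamma ⟨v, E.mem_bdd_of_ae_eq hv⟩ u u :=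
  (E.exists_bddEnergy hreg u).choose_spec.1 φ _ hv

/-- The energy of a set, as a quadratic form on bounded elements. -/
noncomputable def bddEnergyReal (u : E.bdd) (B : Set X) : ℝ :=
  (E.bddEnergy hreg u : Measure X).real B

lemma bddEnergyReal_nonneg (u : E.bdd) (B : Set X) : 0 ≤ E.bddEnergyReal hreg u B :=
  measureReal_nonneg

lemma bddEnergyReal_le (u : E.bdd) (B : Set X) :
    E.bddEnergyReal hreg u B ≤ 2 * E.form u.1 u.1 :=
  (measureReal_mono (Set.subset_univ B)).trans (E.exists_bddEnergy hreg u).choose_spec.2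

/-- Transfers every linear relation among the functionals `φ ↦ E.gamma φ u u` to the masses of sets.
The identities of a quadratic form in `u` follow. -/
lemma sum_bddEnergyReal_eq_zero {ι : Type*} [Fintype ι] (c : ι → ℝ) (u : ι → E.bdd)
    (h : ∀ φ : E.bdd, ∑ i, c i * E.gamma φ (u i) (u i) = 0) (B : Set X) :
    ∑ i, c i * E.bddEnergyReal hreg (u i) B = 0 :=
  E.sum_measureReal_eq_zero hreg c (fun i => E.bddEnergy hreg (u i)) (fun φ v hv => by
    simp only [E.integral_bddEnergy hreg _ hv]; exact h _) B

lemma bddEnergyReal_add_add (u v w : E.bdd) (B : Set X) :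
    E.bddEnergyReal hreg (u + v + w) B + E.bddEnergyReal hreg u B + E.bddEnergyReal hreg v B
      + E.bddEnergyReal hreg w B = E.bddEnergyReal hreg (u + v) B + E.bddEnergyReal hreg (u + w) B
      + E.bddEnergyReal hreg (v + w) B := by
  have := E.sum_bddEnergyReal_eq_zero hreg ![1, 1, 1, 1, -1, -1, -1]
    ![u + v + w, u, v, w, u + v, u + w, v + w] (fun φ => by
    simp [Fin.sum_univ_succ, gamma_add_middle, gamma_add_right]; ring) B
  simp [Fin.sum_univ_succ] at this
  linarith

lemma bddEnergyReal_smul_add (c : ℝ) (u v : E.bdd) (B : Set X) :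
    E.bddEnergyReal hreg (c • u + v) B = c ^ 2 * E.bddEnergyReal hreg u B
      + E.bddEnergyReal hreg v B + c * (E.bddEnergyReal hreg (u + v) B
        - E.bddEnergyReal hreg u B - E.bddEnergyReal hreg v B) := by
  have := E.sum_bddEnergyReal_eq_zero hreg ![1, -c ^ 2 + c, -1 + c, -c]
    ![c • u + v, u, v, u + v] (fun φ => by
    simp [Fin.sum_univ_succ, gamma_add_middle, gamma_add_right, gamma_smul_middle,
      gamma_smul_right]; ring) B
  simp [Fin.sum_univ_succ] at this
  linarith

end BoundedEnergy

/-- The polar form of a function that satisfies the identities of a quadratic form. -/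
noncomputable def _root_.bilinOfQuadratic {V : Type*} [AddCommGroup V] [Module ℝ V] (q : V → ℝ)
    (h3 : ∀ u v w, q (u + v + w) + q u + q v + q w = q (u + v) + q (u + w) + q (v + w))
    (hs : ∀ (c : ℝ) u v, q (c • u + v) = c ^ 2 * q u + q v + c * (q (u + v) - q u - q v)) :
    V →ₗ[ℝ] V →ₗ[ℝ] ℝ :=
  have h0 : q 0 = 0 := by simpa using h3 0 0 0
  have hc : ∀ (c : ℝ) u, q (c • u) = c ^ 2 * q u := fun c u => by simpa [h0] using hs c u 0
  LinearMap.mk₂ ℝ (fun u v => (q (u + v) - q u - q v) / 2)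
    (fun u u' v => by have := h3 u u' v; linarith)
    (fun c u v => by rw [hs, hc, smul_eq_mul]; ring)
    (fun u v v' => by
      have := h3 u v v'
      rw [← add_assoc]; linarith)
    (fun c u v => by rw [add_comm u, hs, hc, add_comm v u, smul_eq_mul]; ring)

lemma _root_.bilinOfQuadratic_apply {V : Type*} [AddCommGroup V] [Module ℝ V] {q : V → ℝ}
    (h3 : ∀ u v w, q (u + v + w) + q u + q v + q w = q (u + v) + q (u + w) + q (v + w))
    (hs : ∀ (c : ℝ) u v, q (c • u + v) = c ^ 2 * q u + q v + c * (q (u + v) - q u - q v))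
    (u v : V) : bilinOfQuadratic q h3 hs u v = (q (u + v) - q u - q v) / 2 := rfl

lemma _root_.bilinOfQuadratic_self {V : Type*} [AddCommGroup V] [Module ℝ V] {q : V → ℝ}
    (h3 : ∀ u v w, q (u + v + w) + q u + q v + q w = q (u + v) + q (u + w) + q (v + w))
    (hs : ∀ (c : ℝ) u v, q (c • u + v) = c ^ 2 * q u + q v + c * (q (u + v) - q u - q v))
    (u : V) : bilinOfQuadratic q h3 hs u u = q u := by
  have h0 : q 0 = 0 := by simpa using h3 0 0 0
  have hc : q ((2 : ℝ) • u) = 2 ^ 2 * q u := by simpa [h0] using hs 2 u 0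
  rw [bilinOfQuadratic_apply, ← two_smul ℝ u, hc]; ring

/-- Cauchy–Schwarz for the polar form, using `b (u - v) (u + v) = q u - q v`. -/
lemma _root_.sq_sub_le_of_quadratic {V : Type*} [AddCommGroup V] [Module ℝ V] {q : V → ℝ}
    (h3 : ∀ u v w, q (u + v + w) + q u + q v + q w = q (u + v) + q (u + w) + q (v + w))
    (hs : ∀ (c : ℝ) u v, q (c • u + v) = c ^ 2 * q u + q v + c * (q (u + v) - q u - q v))
    (hq : ∀ u, 0 ≤ q u) (u v : V) :
    (q u - q v) ^ 2 ≤ q (u - v) * q (u + v) := by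
  set b := bilinOfQuadratic q h3 hs with hb
  have hbq : ∀ u, b u u = q u := bilinOfQuadratic_self h3 hs
  have hsymm : ∀ u v, b u v = b v u := fun u v => by
    rw [hb, bilinOfQuadratic_apply, bilinOfQuadratic_apply, add_comm u v]; ring
  have h := LinearMap.BilinForm.apply_mul_apply_le_of_forall_zero_le b
    (fun x => by rw [hbq]; exact hq x) (u - v) (u + v)
  rw [hsymm (u + v), hbq, hbq] at h
  have h1 : b (u - v) (u + v) = q u - q v := by
    rw [← hbq u, ← hbq v]
    simp only [map_sub, map_add, LinearMap.sub_apply]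
    rw [hsymm v u]; ring
  rw [h1] at h
  linarith [h]

section Energy

variable {X : Type*} [TopologicalSpace X] [SecondCountableTopology X]
  [LocallyCompactSpace X] [TopologicalSpace.MetrizableSpace X] [MeasurableSpace X] [BorelSpace X]
  {m : Measure X} [m.Regular] (E : DirichletForm m) (hreg : E.IsRegular)

/-- The right side does not involve `B`. This uniformity is what the setwise limit requires. -/
lemma abs_bddEnergyReal_sub_le (u v : E.bdd) (B : Set X) :
    |E.bddEnergyReal hreg u B - E.bddEnergyReal hreg v B|
      ≤ 2 * √(E.form (u.1 - v.1) (u.1 - v.1)) * √(E.form (u.1 + v.1) (u.1 + v.1)) := by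
  have h := sq_sub_le_of_quadratic (q := fun u => E.bddEnergyReal hreg u B)
    (fun u v w => E.bddEnergyReal_add_add hreg u v w B)
    (fun c u v => E.bddEnergyReal_smul_add hreg c u v B)
    (fun u => E.bddEnergyReal_nonneg hreg u B) u v
  have h1 := mul_le_mul (E.bddEnergyReal_le hreg (u - v) B) (E.bddEnergyReal_le hreg (u + v) B)
    (E.bddEnergyReal_nonneg hreg _ B) (mul_nonneg zero_le_two (E.nonneg _))
  refine abs_le_of_sq_le_sq ((h.trans h1).trans (le_of_eq ?_)) (by positivity)
  rw [mul_pow, mul_pow, Real.sq_sqrt (E.nonneg _), Real.sq_sqrt (E.nonneg _)]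
  simp only [Submodule.coe_sub, Submodule.coe_add]; ring

/-- Along bounded sequences converging in the domain, the energies of sets are uniformly close. -/
lemma tendsto_bddEnergyReal_sub {u v : ℕ → E.bdd} {f : E.domain} {ι : Type*} {l : Filter ι}
    {a b : ι → ℕ} (ha : Tendsto a l atTop) (hb : Tendsto b l atTop)
    (hu : Tendsto (fun k => E.normSq ((u k).1 - f)) atTop (𝓝 0))
    (hv : Tendsto (fun k => E.normSq ((v k).1 - f)) atTop (𝓝 0)) :
    ∃ r : ι → ℝ, Tendsto r l (𝓝 0) ∧ ∀ i B,
      |E.bddEnergyReal hreg (u (a i)) B - E.bddEnergyReal hreg (v (b i)) B| ≤ r i := by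
  set s : ι → ℝ := fun i => 2 * E.form ((u (a i)).1 - f) ((u (a i)).1 - f)
    + 2 * E.form ((v (b i)).1 - f) ((v (b i)).1 - f) with hs
  set t : ι → ℝ := fun i => 2 * E.form ((u (a i)).1) ((u (a i)).1)
    + 2 * E.form ((v (b i)).1) ((v (b i)).1) with ht
  have hs0 : Tendsto s l (𝓝 0) := by
    have := (((E.tendsto_normSq_imp_form_sub hu).comp ha).const_mul 2).add
      (((E.tendsto_normSq_imp_form_sub hv).comp hb).const_mul 2)
    rw [mul_zero, add_zero] at this
    exact this
  have ht0 : Tendsto t l (𝓝 (2 * E.form f f + 2 * E.form f f)) :=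
    (((E.tendsto_form_self hu).comp ha).const_mul 2).add
      (((E.tendsto_form_self hv).comp hb).const_mul 2)
  refine ⟨fun i => 2 * √(s i) * √(t i), ?_, fun i B => ?_⟩
  · have := (hs0.sqrt.const_mul 2).mul ht0.sqrt
    simpa using this
  · refine (E.abs_bddEnergyReal_sub_le hreg _ _ B).trans ?_
    change _ ≤ 2 * √(s i) * √(t i)
    gcongr
    · have h1 : (u (a i)).1 - (v (b i)).1 = ((u (a i)).1 - f) + -((v (b i)).1 - f) := by abel
      have h2 := E.form_add_self_le ((u (a i)).1 - f) (-((v (b i)).1 - f))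
      rw [h1]
      simpa only [map_neg, LinearMap.neg_apply, neg_neg] using h2
    · exact E.form_add_self_le _ _

lemma isBoundedEnergyMeasure_bddEnergy (u : E.bdd) :
    E.IsBoundedEnergyMeasure u.1 (E.bddEnergy hreg u) := by
  refine ⟨u.2, fun φ v hv => ?_⟩
  refine ⟨(E.mulB u ⟨v, E.mem_bdd_of_ae_eq hv⟩).1, (E.mulB u u).1, ?_, ?_, ?_⟩
  · filter_upwards [E.mulB_ae u ⟨v, E.mem_bdd_of_ae_eq hv⟩, hv] with x h1 h2
    rw [h1, h2]
  · filter_upwards [E.mulB_ae u u] with x h1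
    rw [h1, sq]
  · rw [E.integral_bddEnergy hreg u hv, gamma_self]

lemma IsBoundedEnergyMeasure.exists_eq_bddEnergy {f : E.domain} {μ : FiniteMeasure X}
    (h : E.IsBoundedEnergyMeasure f μ) : ∃ u : E.bdd, u.1 = f ∧ μ = E.bddEnergy hreg u := by
  refine ⟨⟨f, h.1⟩, rfl, E.finiteMeasure_ext hreg fun φ v hv => ?_⟩
  obtain ⟨v', w', h1, h2, h3⟩ := h.2 φ v hv
  rw [h3, E.integral_bddEnergy hreg _ hv, gamma_self]
  have e1 : v' = (E.mulB ⟨f, h.1⟩ ⟨v, E.mem_bdd_of_ae_eq hv⟩).1 := E.ext_ae (by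
    filter_upwards [E.mulB_ae ⟨f, h.1⟩ ⟨v, E.mem_bdd_of_ae_eq hv⟩, h1, hv] with x a1 a2 a3
    rw [a1, a2, a3])
  have e2 : w' = (E.mulB ⟨f, h.1⟩ ⟨f, h.1⟩).1 := E.ext_ae (by
    filter_upwards [E.mulB_ae ⟨f, h.1⟩ ⟨f, h.1⟩, h2] with x a1 a2
    rw [a1, a2, sq])
  rw [e1, e2]

omit [SecondCountableTopology X] [LocallyCompactSpace X] [TopologicalSpace.MetrizableSpace X]
  [BorelSpace X] [m.Regular] in
lemma exists_seq_compactlySupported (hreg : E.IsRegular) (f : E.domain) :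
    ∃ (φ : ℕ → C_c(X, ℝ)) (u : ℕ → E.bdd), (∀ k, (u k).1.1 =ᵐ[m] φ k) ∧
      Tendsto (fun k => E.normSq ((u k).1 - f)) atTop (𝓝 0) := by
  have := fun k : ℕ => hreg.dense_in_domain f (1 / ((k : ℝ) + 1)) (by positivity)
  choose φ u hu hn using this
  refine ⟨φ, fun k => ⟨u k, E.mem_bdd_of_ae_eq (hu k)⟩, hu, ?_⟩
  refine squeeze_zero (fun k => E.normSq_nonneg _) (fun k => ?_)
    tendsto_one_div_add_atTop_nhds_zero_nat
  have h1 : E.normSq (u k - f) = E.normSq (f - u k) := by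
    rw [← neg_sub f (u k)]
    simp only [normSq, map_neg, LinearMap.neg_apply, neg_neg, Submodule.coe_neg, norm_neg]
  rw [h1]
  exact (hn k).le

lemma isEnergyMeasure_energyMeasure (hreg : E.IsRegular) (f : E.domain) :
    E.IsEnergyMeasure f (E.energyMeasure f) := by
  have hex : ∃ μ, E.IsEnergyMeasure f μ := by
    obtain ⟨-, u, -, hu⟩ := E.exists_seq_compactlySupported hreg f
    obtain ⟨μ, hμ⟩ := exists_setwise_limit (fun k => E.bddEnergy hreg (u k)) (by
      intro ε hε
      -- With the product filter and its two projections, the comparison of two sequences becomes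
      -- the uniform Cauchy property of one.
      obtain ⟨r, hr, hr'⟩ := E.tendsto_bddEnergyReal_sub hreg (l := atTop ×ˢ atTop)
        tendsto_fst tendsto_snd hu hu
      have h1 := hr.eventually (ge_mem_nhds hε)
      rw [prod_atTop_atTop_eq, eventually_atTop] at h1
      obtain ⟨⟨N, M⟩, hN⟩ := h1
      refine ⟨max N M, fun j hj k hk B _ => (hr' (j, k) B).trans (hN (j, k) ?_)⟩
      exact ⟨(le_max_left _ _).trans hj, (le_max_right _ _).trans hk⟩)
    refine ⟨μ, fun k => (u k).1, fun k => E.bddEnergy hreg (u k),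
      fun k => E.isBoundedEnergyMeasure_bddEnergy hreg (u k), hu, fun B hB => ?_⟩
    rw [← ENNReal.tendsto_toReal_iff (fun k => measure_ne_top _ _) (measure_ne_top _ _)]
    exact hμ B hB
  rw [energyMeasure, dif_pos hex]
  exact hex.choose_spec

/-- The chosen energy measure comes with some approximating sequence. Any other bounded sequence
with the same limit has asymptotically the same masses, so the measure may be computed along
whichever sequence is convenient. -/
lemma tendsto_bddEnergyReal {u : ℕ → E.bdd} {f : E.domain}
    (hu : Tendsto (fun k => E.normSq ((u k).1 - f)) atTop (𝓝 0)) {B : Set X}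
    (hB : MeasurableSet B) :
    Tendsto (fun k => E.bddEnergyReal hreg (u k) B) atTop
      (𝓝 ((E.energyMeasure f : Measure X).real B)) := by
  obtain ⟨v, μs, h1, h2, h3⟩ := E.isEnergyMeasure_energyMeasure hreg f
  have := fun k => (h1 k).exists_eq_bddEnergy E hreg
  choose w hw hμ using this
  have h4 := (ENNReal.tendsto_toReal (measure_ne_top _ B)).comp (h3 B hB)
  have h5 : Tendsto (fun k => E.bddEnergyReal hreg (w k) B) atTop
      (𝓝 ((E.energyMeasure f : Measure X).real B)) :=
    h4.congr fun k => by rw [bddEnergyReal, ← hμ]; rfl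
  obtain ⟨r, hr, hr'⟩ := E.tendsto_bddEnergyReal_sub hreg tendsto_id tendsto_id hu
    (v := w) (by simpa only [hw] using h2)
  have h6 : Tendsto (fun k => E.bddEnergyReal hreg (u k) B - E.bddEnergyReal hreg (w k) B) atTop
      (𝓝 0) := squeeze_zero_norm (fun k => hr' k B) hr
  simpa using h6.add h5

lemma energyMeasure_bdd (u : E.bdd) : E.energyMeasure u.1 = E.bddEnergy hreg u := by
  refine FiniteMeasure.toMeasure_injective (Measure.ext fun B hB => ?_)
  have h := E.tendsto_bddEnergyReal hreg (u := fun _ => u) (f := u.1) (by simp [normSq]) hB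
  have h2 := tendsto_nhds_unique h tendsto_const_nhds
  exact (ENNReal.toReal_eq_toReal_iff' (measure_ne_top _ _) (measure_ne_top _ _)).1 h2

lemma energyMeasure_add_add (hreg : E.IsRegular) (u v w : E.domain) {B : Set X}
    (hB : MeasurableSet B) :
    (E.energyMeasure (u + v + w) : Measure X).real B + (E.energyMeasure u : Measure X).real B
      + (E.energyMeasure v : Measure X).real B + (E.energyMeasure w : Measure X).real B
    = (E.energyMeasure (u + v) : Measure X).real B + (E.energyMeasure (u + w) : Measure X).real B
      + (E.energyMeasure (v + w) : Measure X).real B := by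
  obtain ⟨-, u', -, hu⟩ := E.exists_seq_compactlySupported hreg u
  obtain ⟨-, v', -, hv⟩ := E.exists_seq_compactlySupported hreg v
  obtain ⟨-, w', -, hw⟩ := E.exists_seq_compactlySupported hreg w
  have t := fun {a : ℕ → E.bdd} {f : E.domain}
    (h : Tendsto (fun k => E.normSq ((a k).1 - f)) atTop (𝓝 0)) =>
      E.tendsto_bddEnergyReal hreg h hB
  have huv := E.tendsto_normSq_add hu hv
  have h1 := (((t (a := fun k => u' k + v' k + w' k) (E.tendsto_normSq_add huv hw)).add
    (t hu)).add (t hv)).add (t hw)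
  have h2 := ((t (a := fun k => u' k + v' k) huv).add
    (t (a := fun k => u' k + w' k) (E.tendsto_normSq_add hu hw))).add
    (t (a := fun k => v' k + w' k) (E.tendsto_normSq_add hv hw))
  exact tendsto_nhds_unique h1 (h2.congr fun k => (E.bddEnergyReal_add_add hreg _ _ _ B).symm)

lemma energyMeasure_smul_add (hreg : E.IsRegular) (c : ℝ) (u v : E.domain) {B : Set X}
    (hB : MeasurableSet B) :
    (E.energyMeasure (c • u + v) : Measure X).real B
    = c ^ 2 * (E.energyMeasure u : Measure X).real B + (E.energyMeasure v : Measure X).real B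
      + c * ((E.energyMeasure (u + v) : Measure X).real B
        - (E.energyMeasure u : Measure X).real B - (E.energyMeasure v : Measure X).real B) := by
  obtain ⟨-, u', -, hu⟩ := E.exists_seq_compactlySupported hreg u
  obtain ⟨-, v', -, hv⟩ := E.exists_seq_compactlySupported hreg v
  have t := fun {a : ℕ → E.bdd} {f : E.domain}
    (h : Tendsto (fun k => E.normSq ((a k).1 - f)) atTop (𝓝 0)) =>
      E.tendsto_bddEnergyReal hreg h hB
  have h1 := t (a := fun k => c • u' k + v' k)
    (E.tendsto_normSq_add (E.tendsto_normSq_smul c hu) hv)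
  have h2 := (((t hu).const_mul (c ^ 2)).add (t hv)).add
    ((((t (a := fun k => u' k + v' k) (E.tendsto_normSq_add hu hv)).sub (t hu)).sub
      (t hv)).const_mul c)
  exact tendsto_nhds_unique h1 (h2.congr fun k => (E.bddEnergyReal_smul_add hreg _ _ _ B).symm)

/-- The value of the mutual energy measure at a measurable set, as a bilinear form. -/
noncomputable def energyBilin (hreg : E.IsRegular) (B : Set X) (hB : MeasurableSet B) :
    E.domain →ₗ[ℝ] E.domain →ₗ[ℝ] ℝ :=
  bilinOfQuadratic (fun u => (E.energyMeasure u : Measure X).real B)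
    (fun u v w => E.energyMeasure_add_add hreg u v w hB)
    (fun c u v => E.energyMeasure_smul_add hreg c u v hB)

lemma energyBilin_self (B : Set X) (hB : MeasurableSet B) (u : E.domain) :
    E.energyBilin hreg B hB u u = (E.energyMeasure u : Measure X).real B :=
  bilinOfQuadratic_self (q := fun u => (E.energyMeasure u : Measure X).real B) _ _ u

lemma energyBilin_eq (B : Set X) (hB : MeasurableSet B) (u v : E.domain) :
    E.energyBilin hreg B hB u v = E.mutualEnergyMeasure u v B := by
  change ((E.energyMeasure (u + v) : Measure X).real B - (E.energyMeasure u : Measure X).real B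
    - (E.energyMeasure v : Measure X).real B) / 2 = _
  simp only [mutualEnergyMeasure, _root_.smul_apply, _root_.sub_apply, smul_eq_mul,
    Measure.toSignedMeasure_apply_measurable hB]
  ring

lemma sq_energyMeasure_sub_le (hreg : E.IsRegular) (u v : E.domain) {B : Set X}
    (hB : MeasurableSet B) :
    ((E.energyMeasure u : Measure X).real B - (E.energyMeasure v : Measure X).real B) ^ 2
      ≤ (E.energyMeasure (u - v) : Measure X).real B
        * (E.energyMeasure (u + v) : Measure X).real B :=
  sq_sub_le_of_quadratic (q := fun u => (E.energyMeasure u : Measure X).real B)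
    (fun u v w => E.energyMeasure_add_add hreg u v w hB)
    (fun c u v => E.energyMeasure_smul_add hreg c u v hB)
    (fun _ => measureReal_nonneg) u v

end Energy

/-! ### Consequences of strong locality. -/

section Locality

variable {X : Type*} [TopologicalSpace X] [MeasurableSpace X] {m : Measure X}
  (E : DirichletForm m)

lemma supp_subset_tsupport [BorelSpace X] {f : E.domain} {φ : X → ℝ} (h : f.1 =ᵐ[m] φ) :
    E.supp f ⊆ tsupport φ := by
  refine Measure.support_subset_of_isClosed (isClosed_tsupport φ) ?_
  rw [mem_ae_iff, withDensity_apply _ (isClosed_tsupport φ).measurableSet.compl,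
    lintegral_eq_zero_iff' (Lp.aestronglyMeasurable f.1).aemeasurable.enorm.restrict]
  filter_upwards [ae_restrict_of_ae h, ae_restrict_mem (isClosed_tsupport φ).measurableSet.compl]
    with x h1 h2
  rw [h1, image_eq_zero_of_notMem_tsupport h2]
  simp

lemma isCompact_supp [BorelSpace X] {f : E.domain} {φ : X → ℝ} (h : f.1 =ᵐ[m] φ)
    (hφ : HasCompactSupport φ) : IsCompact (E.supp f) :=
  hφ.isCompact.of_isClosed_subset Measure.isClosed_support (E.supp_subset_tsupport h)

lemma form_eq_zero_of_const [BorelSpace X] (hloc : E.IsStronglyLocal) {f g : E.domain} {φ χ : X → ℝ} {U : Set X}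
    {c : ℝ} (hf : f.1 =ᵐ[m] φ) (hφ : HasCompactSupport φ) (hg : g.1 =ᵐ[m] χ)
    (hχ : HasCompactSupport χ) (hU : IsOpen U) (hφU : tsupport φ ⊆ U) (hc : ∀ x ∈ U, χ x = c) :
    E.form f g = 0 := by
  refine hloc f g (E.isCompact_supp hf hφ) (E.isCompact_supp hg hχ)
    ⟨U, c, hU, (E.supp_subset_tsupport hf).trans hφU, ?_⟩
  filter_upwards [hg] with x h hx
  rw [h, hc x hx]

lemma cap_empty : E.cap ∅ = 0 := by
  refine le_antisymm ?_ bot_le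
  refine (iInf_le _ ∅).trans ((iInf_le _ isOpen_empty).trans ((iInf_le _ le_rfl).trans
    ((iInf_le _ 0).trans ((iInf_le _ (Eventually.of_forall fun x hx => hx.elim)).trans ?_))))
  simp [normSq]

lemma isQuasiOpen_of_isOpen {U : Set X} (hU : IsOpen U) : E.IsQuasiOpen U := fun ε hε =>
  ⟨U, hU, le_rfl, by rw [Set.sdiff_self, cap_empty]; exact hε⟩

variable [SecondCountableTopology X]
  [LocallyCompactSpace X] [TopologicalSpace.MetrizableSpace X] [BorelSpace X] [m.Regular]

omit [BorelSpace X] in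
lemma exists_cutoff (hreg : E.IsRegular) {K : Set X} (hK : IsCompact K) :
    ∃ (χ : C_c(X, ℝ)) (u : E.bdd), u.1.1 =ᵐ[m] χ ∧ (∀ x, 0 ≤ χ x ∧ χ x ≤ 1) ∧
      ∃ U, IsOpen U ∧ K ⊆ U ∧ ∀ x ∈ U, χ x = 1 := by
  obtain ⟨K', hK', hKK'⟩ := exists_compact_superset hK
  obtain ⟨f, hf1, hf2, -, -⟩ := exists_continuousMap_one_of_isCompact_subset_isOpen hK'
    isOpen_univ (Set.subset_univ K')
  -- Approximating `2f` within `1` gives values above `1` on `K'`, so truncation to `[0,1]` equals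
  -- exactly `1` there.
  obtain ⟨φ, w, hw, hφ⟩ := hreg.dense_in_continuous ((2 : ℝ) • ⟨f, hf2⟩) 1 one_pos
  obtain ⟨χ, u, h1, h2⟩ := E.exists_lipschitz_comp_compactlySupported (L := 1)
    (T := fun a => min (max a 0) 1)
    (fun a b => by
      have h1 := abs_max_sub_max_le_abs a b 0
      have h2 := abs_min_sub_min_le_max (max a 0) 1 (max b 0) 1
      rw [sub_self (1 : ℝ), abs_zero, max_eq_left (abs_nonneg (max a 0 - max b 0))] at h2
      rw [one_mul]; exact h2.trans h1) (by simp) hw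
  refine ⟨χ, u, h2, fun x => ?_, interior K', isOpen_interior, hKK', fun x hx => ?_⟩
  · rw [h1]; exact ⟨le_min (le_max_right _ _) zero_le_one, min_le_right _ _⟩
  · have h3 : f x = 1 := hf1 (interior_subset hx)
    have h4 : |2 * f x - φ x| < 1 := hφ x
    rw [h3] at h4
    have := (abs_lt.1 h4).2
    rw [h1, max_eq_left (by linarith), min_eq_right (by linarith)]

omit [BorelSpace X] in
lemma exists_compactlySupported_ge_one (hreg : E.IsRegular) {K G : Set X} (hK : IsCompact K)
    (hG : IsOpen G) (hKG : K ⊆ G) :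
    ∃ (φ : C_c(X, ℝ)) (u : E.bdd), u.1.1 =ᵐ[m] φ ∧ (∀ x, 0 ≤ φ x) ∧ (∀ x ∈ K, 1 ≤ φ x) ∧
      tsupport φ ⊆ G := by
  obtain ⟨f, hf1, hf2, hf3, -⟩ := exists_continuousMap_one_of_isCompact_subset_isOpen hK hG hKG
  -- Approximating `3f` within `1` and then subtracting `1` leaves values above `1` on `K`, while
  -- the positive part vanishes wherever `f` does.
  obtain ⟨φ, w, hw, hφ⟩ := hreg.dense_in_continuous ((3 : ℝ) • ⟨f, hf2⟩) 1 one_pos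
  obtain ⟨χ, u, h1, h2⟩ := E.exists_lipschitz_comp_compactlySupported (L := 1)
    (T := fun a => max (a - 1) 0)
    (fun a b => by
      have h1 := abs_max_sub_max_le_abs (a - 1) (b - 1) 0
      rw [one_mul]; exact h1.trans (le_of_eq (by ring_nf))) (by simp) hw
  refine ⟨χ, u, h2, fun x => ?_, fun x hx => ?_, ?_⟩
  · rw [h1]; exact le_max_right _ _
  · have h3 : f x = 1 := hf1 hx
    have h4 : |3 * f x - φ x| < 1 := hφ x
    rw [h3] at h4
    have := (abs_lt.1 h4).2
    rw [h1]; exact le_max_of_le_left (by linarith)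
  · refine (closure_mono ?_).trans hf3
    intro x hx
    by_contra h3
    have h4 : f x = 0 := by simpa using h3
    have h5 : |3 * f x - φ x| < 1 := hφ x
    rw [h4] at h5
    have := (abs_lt.1 h5).1
    refine hx ?_
    rw [h1, max_eq_right (by linarith)]

omit [TopologicalSpace.MetrizableSpace X] [BorelSpace X] in
lemma mulB_ae_of_ae {u v : E.bdd} {φ ψ : X → ℝ} (hu : u.1.1 =ᵐ[m] φ) (hv : v.1.1 =ᵐ[m] ψ) :
    (E.mulB u v).1.1 =ᵐ[m] φ * ψ := by
  filter_upwards [E.mulB_ae u v, hu, hv] with x h1 h2 h3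
  rw [h1, h2, h3]; rfl

/-- The total mass of the energy measure of an element of `F ∩ C_c(X)`. -/
lemma bddEnergyReal_univ (hreg : E.IsRegular) (hloc : E.IsStronglyLocal) {u : E.bdd}
    {φ : C_c(X, ℝ)} (hu : u.1.1 =ᵐ[m] φ) :
    E.bddEnergyReal hreg u Set.univ = 2 * E.form u.1 u.1 := by
  refine le_antisymm (E.bddEnergyReal_le hreg u _) ?_
  -- Testing with a cutoff equal to `1` near the support: the product with `u` is `u`, and `E(χ, u²)
  -- = 0` by strong locality, so the integral of `χ` is already `2E(u,u)`.
  obtain ⟨χ, v, hv, hχ, U, hU, hKU, hU1⟩ := E.exists_cutoff hreg φ.hasCompactSupport.isCompact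
  have h1 := E.integral_bddEnergy hreg u hv
  have h2 : E.mulB u v = u := Subtype.ext (E.ext_ae (by
    filter_upwards [E.mulB_ae_of_ae hu hv, hu] with x a1 a2
    rw [a1, a2, Pi.mul_apply]
    by_cases hx : x ∈ tsupport φ
    · rw [hU1 x (hKU hx), mul_one]
    · rw [image_eq_zero_of_notMem_tsupport hx, zero_mul]))
  have h3 : E.form v.1 (E.mulB u u).1 = 0 := by
    rw [E.symm]
    exact E.form_eq_zero_of_const hloc (E.mulB_ae_of_ae hu hu) φ.hasCompactSupport.mul_right hv
      χ.hasCompactSupport hU ((tsupport_mul_subset_left).trans hKU) hU1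
  rw [gamma_self] at h1
  change _ = 2 * E.form (E.mulB u v).1 u.1 - E.form v.1 (E.mulB u u).1 at h1
  rw [h2, h3, sub_zero] at h1
  rw [← h1, bddEnergyReal]
  have h4 : ∫ x, χ x ∂(E.bddEnergy hreg u : Measure X)
      ≤ ∫ _, (1 : ℝ) ∂(E.bddEnergy hreg u : Measure X) :=
    integral_mono (χ.continuous.integrable_of_hasCompactSupport χ.hasCompactSupport)
      (integrable_const _) fun x => (hχ x).2
  simpa using h4

lemma energyMeasure_real_univ (hreg : E.IsRegular) (hloc : E.IsStronglyLocal) (f : E.domain) :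
    (E.energyMeasure f : Measure X).real Set.univ = 2 * E.form f f := by
  obtain ⟨φ, u, hu, hlim⟩ := E.exists_seq_compactlySupported hreg f
  have h1 := E.tendsto_bddEnergyReal hreg hlim MeasurableSet.univ
  have h2 := (E.tendsto_form_self hlim).const_mul 2
  exact tendsto_nhds_unique h1 (h2.congr fun k => (E.bddEnergyReal_univ hreg hloc (hu k)).symm)

/-- Energy measures do not charge open sets on which the function is constant. -/
lemma energyMeasure_eq_zero_of_const (hreg : E.IsRegular) (hloc : E.IsStronglyLocal) {u : E.bdd}
    {χ : C_c(X, ℝ)} (hu : u.1.1 =ᵐ[m] χ) {G : Set X} (hG : IsOpen G) (hχ : ∀ x ∈ G, χ x = 1) :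
    (E.energyMeasure u.1 : Measure X) G = 0 := by
  rw [hG.measure_eq_iSup_isCompact]
  simp only [ENNReal.iSup_eq_zero]
  intro K hKG hK
  -- For a test function supported in `G`, both terms `E(uφ, u)` and `E(φ, u²)` pair it with a
  -- function constant near its support, hence vanish.
  obtain ⟨φ, v, hv, h0, h1, hφG⟩ := E.exists_compactlySupported_ge_one hreg hK hG hKG
  have hint := E.integral_bddEnergy hreg u hv
  rw [gamma_self] at hint
  change _ = 2 * E.form (E.mulB u v).1 u.1 - E.form v.1 (E.mulB u u).1 at hint
  have e1 : E.form (E.mulB u v).1 u.1 = 0 :=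
    E.form_eq_zero_of_const hloc (E.mulB_ae_of_ae hu hv) φ.hasCompactSupport.mul_left hu
      χ.hasCompactSupport hG (tsupport_mul_subset_right.trans hφG) hχ
  have e2 : E.form v.1 (E.mulB u u).1 = 0 :=
    E.form_eq_zero_of_const hloc hv φ.hasCompactSupport (E.mulB_ae_of_ae hu hu)
      χ.hasCompactSupport.mul_right hG hφG (c := 1)
      (fun x hx => by rw [Pi.mul_apply, hχ x hx, one_mul])
  rw [e1, e2, mul_zero, sub_zero] at hint
  rw [E.energyMeasure_bdd hreg]
  have hφi : Integrable φ (E.bddEnergy hreg u : Measure X) :=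
    φ.continuous.integrable_of_hasCompactSupport φ.hasCompactSupport
  rw [integral_eq_zero_iff_of_nonneg h0 hφi] at hint
  refine measure_mono_null (fun x hx => ?_) hint
  have := h1 x hx
  change ¬ (φ x = 0)
  linarith

/-- Inside `G` the perturbation `c • v` has zero energy, so Cauchy–Schwarz on each Borel subset
leaves the energy of `f` unchanged. -/
lemma energyMeasure_sub_smul_restrict (hreg : E.IsRegular) (f : E.domain) {v : E.domain} (c : ℝ)
    {G : Set X} (hG : IsOpen G) (hv : (E.energyMeasure v : Measure X) G = 0) :
    (E.energyMeasure (f - c • v) : Measure X).restrict G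
      = (E.energyMeasure f : Measure X).restrict G := by
  refine Measure.ext fun B hB => ?_
  have hBG := hB.inter hG.measurableSet
  rw [Measure.restrict_apply hB, Measure.restrict_apply hB]
  have h1 := E.sq_energyMeasure_sub_le hreg (f - c • v) f hBG
  have h2 : (E.energyMeasure (f - c • v - f) : Measure X).real (B ∩ G) = 0 := by
    rw [show f - c • v - f = (-c) • v by module, ← E.energyBilin_self hreg _ hBG, map_smul, map_smul,
      LinearMap.smul_apply, E.energyBilin_self hreg _ hBG, measureReal_def,
      measure_mono_null Set.inter_subset_right hv]
    simp
  rw [h2, zero_mul] at h1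
  have h3 := sub_eq_zero.1 (pow_eq_zero_iff two_ne_zero |>.1 (le_antisymm h1 (sq_nonneg _)))
  exact (ENNReal.toReal_eq_toReal_iff' (measure_ne_top _ _) (measure_ne_top _ _)).1 h3

/-- Elements of the domain plus constants belong to it locally in the broad sense, with the same
energy measure. -/
lemma isLocalEnergyMeasure_sub_const (hreg : E.IsRegular) (hloc : E.IsStronglyLocal)
    (f : E.domain) (c : ℝ) {R : X → ℝ} (hR : R =ᵐ[m] fun x => f.1 x - c) :
    E.MemLoc R ∧ E.IsLocalEnergyMeasure R (E.energyMeasure f) := by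
  set K := CompactExhaustion.choice X with hK
  have hKi : (⋃ k, interior (K k)) = Set.univ :=
    Set.iUnion_eq_univ_iff.2 fun x => by
      obtain ⟨k, hk⟩ := K.exists_mem x
      exact ⟨k + 1, K.subset_interior_succ k hk⟩
  have hcut := fun k => E.exists_cutoff hreg (K.isCompact k)
  choose χ v hv h01 U hU hKU hU1 using hcut
  -- The constant is replaced on the `k`-th set by `c` times a cutoff equal to `1` there. The sets
  -- are open and exhaust `X`, so no exceptional set is left.
  have hL : E.IsLocalization R (fun k => interior (K k)) (fun k => f - c • (v k).1) :=
    { measurableSet := fun k => isOpen_interior.measurableSet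
      quasiOpen := fun k => E.isQuasiOpen_of_isOpen isOpen_interior
      mono := fun k => interior_mono (K.subset_succ k)
      exhausts := by
        rw [hKi, Set.compl_univ, cap_empty]
      eq_on := fun k => by
        filter_upwards [hR, hv k, Lp.coeFn_sub f.1 (c • (v k).1.1), Lp.coeFn_smul c (v k).1.1]
          with x h1 h2 h3 h4 hx
        rw [Submodule.coe_sub, Submodule.coe_smul, h3, Pi.sub_apply, h4, Pi.smul_apply, h2,
          hU1 k x (hKU k (interior_subset hx)), h1, smul_eq_mul, mul_one] }
  refine ⟨⟨?_, _, _, hL⟩, _, _, hL, fun k => ?_, ?_⟩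
  · exact ((Lp.aestronglyMeasurable f.1).aemeasurable.sub_const c).congr hR.symm
  · refine (E.energyMeasure_sub_smul_restrict hreg f c isOpen_interior ?_).symm
    exact E.energyMeasure_eq_zero_of_const hreg hloc (hv k) isOpen_interior
      fun x hx => hU1 k x (hKU k (interior_subset hx))
  · rw [hKi, Set.compl_univ, measure_empty]

end Locality

/-! ### Densities of energy measures and the Gram matrix. -/

section Density

variable {X : Type*} [TopologicalSpace X] [MeasurableSpace X] {m : Measure X}
  (E : DirichletForm m) {ν : Measure X}

lemma mutualEnergyMeasure_comm (f g : E.domain) :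
    E.mutualEnergyMeasure f g = E.mutualEnergyMeasure g f := by
  simp only [mutualEnergyMeasure, add_comm f g]
  rw [sub_right_comm]

lemma density_comm (f g : E.domain) : E.density ν f g = E.density ν g f := by
  rw [density, density, mutualEnergyMeasure_comm]

lemma measurable_density (f g : E.domain) : Measurable (E.density ν f g) :=
  SignedMeasure.measurable_rnDeriv _ _

lemma integrable_density (f g : E.domain) : Integrable (E.density ν f g) ν :=
  SignedMeasure.integrable_rnDeriv _ _

lemma setIntegral_density (hν : E.IsMinimalEnergyDominant ν) (f g : E.domain) {B : Set X}
    (hB : MeasurableSet B) : ∫ x in B, E.density ν f g x ∂ν = E.mutualEnergyMeasure f g B := by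
  have := hν.sigmaFinite
  have hac : E.mutualEnergyMeasure f g ≪ᵥ ν.toENNRealVectorMeasure := by
    -- The mutual measure combines three energy measures, each dominated by `ν`.
    refine VectorMeasure.AbsolutelyContinuous.mk fun B hB h0 => ?_
    rw [Measure.toENNRealVectorMeasure_apply_measurable hB] at h0
    simp only [mutualEnergyMeasure, _root_.smul_apply, _root_.sub_apply,
      Measure.toSignedMeasure_apply_measurable hB, measureReal_def, hν.dominates _ h0]
    simp
  rw [← withDensityᵥ_apply (E.integrable_density f g) hB, density,
    SignedMeasure.withDensityᵥ_rnDeriv_eq _ _ hac]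

lemma integrable_sum_density {ι : Type*} [Fintype ι] (a : ι → ℝ) (f : ι → E.domain) :
    Integrable (fun x => ∑ i, ∑ j, a i * a j * E.density ν (f i) (f j) x) ν :=
  integrable_finsetSum _ fun i _ => integrable_finsetSum _ fun j _ =>
    (E.integrable_density (f i) (f j)).const_mul _

variable [SecondCountableTopology X]
  [LocallyCompactSpace X] [TopologicalSpace.MetrizableSpace X] [BorelSpace X] [m.Regular]

lemma setIntegral_sum_density (hreg : E.IsRegular) (hν : E.IsMinimalEnergyDominant ν) {ι : Type*}
    [Fintype ι] (a : ι → ℝ) (f : ι → E.domain) {B : Set X} (hB : MeasurableSet B) :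
    ∫ x in B, ∑ i, ∑ j, a i * a j * E.density ν (f i) (f j) x ∂ν
      = (E.energyMeasure (∑ i, a i • f i) : Measure X).real B := by
  rw [integral_finsetSum _ fun i _ => integrable_finsetSum _ fun j _ =>
    ((E.integrable_density (f i) (f j)).const_mul _).integrableOn,
    ← E.energyBilin_self hreg B hB]
  simp only [map_sum, LinearMap.sum_apply, map_smul, LinearMap.smul_apply, smul_eq_mul]
  refine Finset.sum_congr rfl fun i _ => ?_
  rw [integral_finsetSum _ fun j _ =>
    ((E.integrable_density (f i) (f j)).const_mul _).integrableOn,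
    Finset.mul_sum]
  refine Finset.sum_congr rfl fun j _ => ?_
  rw [integral_const_mul, E.density_comm, E.setIntegral_density hν _ _ hB, E.energyBilin_eq hreg B hB]
  ring

lemma sum_density_nonneg (hreg : E.IsRegular) (hν : E.IsMinimalEnergyDominant ν) {ι : Type*}
    [Fintype ι] (a : ι → ℝ) (f : ι → E.domain) :
    ∀ᵐ x ∂ν, 0 ≤ ∑ i, ∑ j, a i * a j * E.density ν (f i) (f j) x :=
  ae_nonneg_of_forall_setIntegral_nonneg (E.integrable_sum_density a f) fun B hB _ => by
    rw [E.setIntegral_sum_density hreg hν a f hB]; exact measureReal_nonneg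

lemma withDensity_sum_density (hreg : E.IsRegular) (hν : E.IsMinimalEnergyDominant ν) {ι : Type*}
    [Fintype ι] (a : ι → ℝ) (f : ι → E.domain) :
    ν.withDensity (fun x => ENNReal.ofReal (∑ i, ∑ j, a i * a j * E.density ν (f i) (f j) x))
      = E.energyMeasure (∑ i, a i • f i) := by
  refine Measure.ext fun B hB => ?_
  rw [withDensity_apply _ hB, ← ofReal_integral_eq_lintegral_ofReal
    (E.integrable_sum_density a f).integrableOn
    (ae_restrict_of_ae (E.sum_density_nonneg hreg hν a f)),
    E.setIntegral_sum_density hreg hν a f hB, ofReal_measureReal]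

/-- For fixed coefficients the quadratic form is a density of an energy measure. Passing through
rational coefficients gives one null set for all real vectors, which is needed because the vector
used later varies with `x`. -/
lemma posSemidef_gram (hreg : E.IsRegular) (hν : E.IsMinimalEnergyDominant ν) {ι : Type*}
    [Fintype ι] (f : ι → E.domain) : ∀ᵐ x ∂ν, (E.gram ν f x).PosSemidef := by
  have h1 : ∀ᵐ x ∂ν, ∀ a : ι → ℚ,
      0 ≤ ∑ i, ∑ j, (a i : ℝ) * a j * E.density ν (f i) (f j) x :=
    ae_all_iff.2 fun a => E.sum_density_nonneg hreg hν (fun i => (a i : ℝ)) f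
  filter_upwards [h1] with x hx
  have h2 : ∀ a : ι → ℝ, 0 ≤ ∑ i, ∑ j, a i * a j * E.density ν (f i) (f j) x := by
    intro a
    have hcl : IsClosed {a : ι → ℝ | 0 ≤ ∑ i, ∑ j, a i * a j * E.density ν (f i) (f j) x} :=
      isClosed_le continuous_const (by fun_prop)
    have hd : DenseRange (fun (b : ι → ℚ) i => (b i : ℝ)) :=
      DenseRange.piMap fun _ => Rat.isDenseEmbedding_coe_real.dense
    exact hcl.closure_subset_iff.2 (by rintro _ ⟨q, rfl⟩; exact hx q) (hd a)
  refine .of_dotProduct_mulVec_nonneg ?_ fun a => ?_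
  · ext i j
    simp only [gram, Matrix.conjTranspose_apply, Matrix.of_apply, star_trivial]
    rw [E.density_comm]
  · refine (h2 a).trans (le_of_eq ?_)
    simp only [dotProduct, Matrix.mulVec, gram, Matrix.of_apply, Pi.star_apply, star_trivial,
      Finset.mul_sum]
    refine Finset.sum_congr rfl fun i _ => Finset.sum_congr rfl fun j _ => ?_
    ring

lemma integral_density (hreg : E.IsRegular) (hloc : E.IsStronglyLocal)
    (hν : E.IsMinimalEnergyDominant ν) (f g : E.domain) :
    ∫ x, E.density ν f g x ∂ν = 2 * E.form f g := by
  rw [← setIntegral_univ, E.setIntegral_density hν f g MeasurableSet.univ]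
  simp only [mutualEnergyMeasure, _root_.smul_apply, _root_.sub_apply,
      Measure.toSignedMeasure_apply_measurable MeasurableSet.univ,
      E.energyMeasure_real_univ hreg hloc, form_add_self, smul_eq_mul]
  ring

end Density

/-! ### The remainder as a quadratic form, and its expansion. -/

section Gradient

variable {X : Type*} [TopologicalSpace X] [MeasurableSpace X] {m : Measure X}
  (E : DirichletForm m) {ν : Measure X} {p : X → ℕ∞} {n : ℕ} {g : Fin n → E.domain}
  {f : E.domain} {d : X → Fin n → ℝ}

/-- The coefficients of the remainder. -/
noncomputable def remainderCoeff (n : ℕ) (k : ℕ∞) (d : Fin n → ℝ) : Fin (n + 1) → ℝ :=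
  Fin.cons 1 fun i => if ((i : ℕ) : ℕ∞) < k then -d i else 0

lemma remainderDensity_eq_sum (d : X → Fin n → ℝ) (x y : X) :
    E.remainderDensity ν p g f d x y = ∑ i, ∑ j, remainderCoeff n (p x) (d x) i
      * remainderCoeff n (p x) (d x) j
      * E.density ν ((Fin.cons f g : Fin (n + 1) → E.domain) i)
        ((Fin.cons f g : Fin (n + 1) → E.domain) j) y := by
  simp only [Fin.sum_univ_succ, remainderCoeff, Fin.cons_zero, Fin.cons_succ, remainderDensity,
    firstIndices, Finset.sum_filter, one_mul, mul_one, Finset.sum_add_distrib]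
  have h1 : ∑ i : Fin n, (if ((i : ℕ) : ℕ∞) < p x then -d x i else 0) * E.density ν f (g i) y
      = -∑ i : Fin n, if ((i : ℕ) : ℕ∞) < p x then d x i * E.density ν f (g i) y else 0 := by
    rw [← Finset.sum_neg_distrib]
    refine Finset.sum_congr rfl fun i _ => ?_
    split_ifs <;> simp
  have h2 : ∑ i : Fin n, (if ((i : ℕ) : ℕ∞) < p x then -d x i else 0) * E.density ν (g i) f y
      = -∑ i : Fin n, if ((i : ℕ) : ℕ∞) < p x then d x i * E.density ν f (g i) y else 0 := by
    rw [← h1]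
    refine Finset.sum_congr rfl fun i _ => ?_
    rw [E.density_comm]
  rw [h1, h2]
  have h3 : ∀ i j : Fin n, ((if ((i : ℕ) : ℕ∞) < p x then -d x i else 0)
      * if ((j : ℕ) : ℕ∞) < p x then -d x j else 0) * E.density ν (g i) (g j) y
      = if ((i : ℕ) : ℕ∞) < p x then if ((j : ℕ) : ℕ∞) < p x then
        d x i * d x j * E.density ν (g i) (g j) y else 0 else 0 := fun i j => by
    split_ifs <;> simp
  simp only [h3]
  have h4 : ∀ i : Fin n, (∑ j : Fin n, if ((i : ℕ) : ℕ∞) < p x then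
      if ((j : ℕ) : ℕ∞) < p x then d x i * d x j * E.density ν (g i) (g j) y else 0 else 0)
      = if ((i : ℕ) : ℕ∞) < p x then ∑ j : Fin n, if ((j : ℕ) : ℕ∞) < p x then
        d x i * d x j * E.density ν (g i) (g j) y else 0 else 0 := fun i => by
    split_ifs <;> simp
  simp only [h4]
  ring

omit [TopologicalSpace X] in
lemma sum_remainderCoeff_smul (k : ℕ∞) (d : Fin n → ℝ) :
    ∑ i, remainderCoeff n k d i • (Fin.cons f g : Fin (n + 1) → E.domain) i
      = f - ∑ i ∈ firstIndices n k, d i • g i := by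
  simp only [Fin.sum_univ_succ, remainderCoeff, Fin.cons_zero, Fin.cons_succ, firstIndices,
    Finset.sum_filter, one_smul, sub_eq_add_neg, ← Finset.sum_neg_distrib]
  congr 1
  refine Finset.sum_congr rfl fun i _ => ?_
  split_ifs <;> simp

lemma remainderCoeff_of_eq_zero {k : ℕ∞} {d : Fin n → ℝ}
    (h : ∀ i : Fin n, k ≤ ((i : ℕ) : ℕ∞) → d i = 0) :
    remainderCoeff n k d = Fin.cons 1 fun i => -d i := by
  unfold remainderCoeff
  congr 1
  funext i
  split_ifs with hi
  · rfl
  · rw [h i (not_lt.1 hi), neg_zero]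

variable [SecondCountableTopology X]
  [LocallyCompactSpace X] [TopologicalSpace.MetrizableSpace X] [BorelSpace X] [m.Regular]

/-- For fixed `x` the coefficients are constants, so the energy measure of the remainder is that of
`f - ∑ d_i(x) g_i`. Hence the expansion holds for every coefficient field and every `x`. -/
lemma expansion_of_coeff (hreg : E.IsRegular) (hloc : E.IsStronglyLocal)
    (hν : E.IsMinimalEnergyDominant ν) (d : X → Fin n → ℝ) (ft : X → ℝ) (gt : Fin n → X → ℝ)
    (hft : f.1 =ᵐ[m] ft) (hgt : ∀ i, (g i).1 =ᵐ[m] gt i) :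
    ∃ R : X → X → ℝ,
      (∀ x y, ft y - ft x =
        ∑ i ∈ firstIndices n (p x), d x i * (gt i y - gt i x) + R x y) ∧
      ∀ x, E.MemLoc (R x) ∧ E.IsLocalEnergyMeasure (R x)
        (ν.withDensity fun y => ENNReal.ofReal (E.remainderDensity ν p g f d x y)) := by
  refine ⟨fun x y => ft y - ft x - ∑ i ∈ firstIndices n (p x), d x i * (gt i y - gt i x),
    fun x y => by ring, fun x => ?_⟩
  simp only [remainderDensity_eq_sum]
  rw [E.withDensity_sum_density hreg hν, sum_remainderCoeff_smul]
  refine E.isLocalEnergyMeasure_sub_const hreg hloc _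
    (ft x - ∑ i ∈ firstIndices n (p x), d x i * gt i x) ?_
  have hsum : ∀ s : Finset (Fin n), ∀ᵐ y ∂m, (∑ i ∈ s, d x i • g i : E.domain).1 y
      = ∑ i ∈ s, d x i * gt i y := by
    intro s
    induction s using Finset.induction_on with
    | empty =>
      filter_upwards [Lp.coeFn_zero ℝ 2 m] with y hy
      simp only [Finset.sum_empty, Submodule.coe_zero]
      rw [hy]; rfl
    | insert i s hi ih =>
      filter_upwards [ih, hgt i, Lp.coeFn_add (d x i • (g i).1) (∑ i ∈ s, d x i • g i : E.domain).1,
        Lp.coeFn_smul (d x i) (g i).1] with y h1 h2 h3 h4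
      rw [Finset.sum_insert hi, Finset.sum_insert hi, Submodule.coe_add, Submodule.coe_smul, h3,
        Pi.add_apply, h1, h4, Pi.smul_apply, h2, smul_eq_mul]
  filter_upwards [hft, hsum (firstIndices n (p x)),
    Lp.coeFn_sub f.1 (∑ i ∈ firstIndices n (p x), d x i • g i : E.domain).1] with y h1 h2 h3
  rw [Submodule.coe_sub, h3, Pi.sub_apply, h1, h2]
  simp only [mul_sub, Finset.sum_sub_distrib]
  ring

end Gradient

end DirichletForm

/-! ### Null vectors of singular bordered matrices. -/

/-- If a bordered matrix with invertible corner is singular, its Schur complement vanishes. -/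
lemma Matrix.eq_zero_of_bordered_rank_le {r : ℕ} (M : Matrix (Fin (r + 1)) (Fin (r + 1)) ℝ)
    (hM : M.rank ≤ r) (hZ : IsUnit (Matrix.of fun i j : Fin r => M i.succ j.succ)) :
    M.mulVec (Fin.cons 1 fun i => -(((Matrix.of fun i j : Fin r => M i.succ j.succ)⁻¹).mulVec
      (fun i => M i.succ 0) i)) = 0 := by
  set Z := Matrix.of fun i j : Fin r => M i.succ j.succ with hZdef
  have hdet : M.det = 0 := by
    by_contra h
    have h1 := Matrix.rank_of_isUnit M ((Matrix.isUnit_iff_isUnit_det M).2 (isUnit_iff_ne_zero.2 h))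
    rw [Fintype.card_fin] at h1
    omega
  obtain ⟨w, hw0, hw⟩ := Matrix.exists_mulVec_eq_zero_iff.2 hdet
  have hrow : ∀ i : Fin r, w 0 * M i.succ 0 + Z.mulVec (fun j => w j.succ) i = 0 := fun i => by
    have := congrFun hw i.succ
    simp only [Matrix.mulVec, dotProduct, Fin.sum_univ_succ, Pi.zero_apply] at this
    simp only [Matrix.mulVec, dotProduct, hZdef, Matrix.of_apply]
    linarith
  have hZi : Z⁻¹ * Z = 1 := Matrix.nonsing_inv_mul Z ((Matrix.isUnit_iff_isUnit_det Z).1 hZ)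
  have hsol : (fun j : Fin r => w j.succ) = -(w 0 • Z⁻¹.mulVec (fun i => M i.succ 0)) := by
    have h1 : Z.mulVec (fun j => w j.succ) = -(w 0 • fun i => M i.succ 0) := by
      funext i
      have := hrow i
      simp only [Pi.neg_apply, Pi.smul_apply, smul_eq_mul]
      linarith
    calc (fun j : Fin r => w j.succ) = (Z⁻¹ * Z).mulVec (fun j => w j.succ) := by
          rw [hZi, Matrix.one_mulVec]
      _ = _ := by rw [← Matrix.mulVec_mulVec, h1, Matrix.mulVec_neg, Matrix.mulVec_smul]
  -- A kernel vector with zero first entry would lie in the kernel of the invertible corner.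
  have hw00 : w 0 ≠ 0 := by
    intro h
    refine hw0 (funext fun i => ?_)
    refine Fin.cases h (fun j => ?_) i
    have := congrFun hsol j
    rw [this, h]; simp
  have hwv : w = w 0 • (Fin.cons 1 fun i => -(Z⁻¹.mulVec (fun i => M i.succ 0) i) :
      Fin (r + 1) → ℝ) := by
    funext i
    refine Fin.cases (by simp) (fun j => ?_) i
    have := congrFun hsol j
    simpa using this
  rw [hwv, Matrix.mulVec_smul] at hw
  exact (smul_eq_zero.1 hw).resolve_left hw00

namespace DirichletForm

/-! ### Normal equations, uniqueness and the inner product formula. -/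

section Pointwise

lemma sum_firstIndices {n r : ℕ} (hr : r ≤ n) (F : Fin n → ℝ) :
    ∑ i ∈ firstIndices n r, F i = ∑ j : Fin r, F (Fin.castLE hr j) := by
  refine Eq.trans (Finset.sum_congr ?_ fun _ _ => rfl)
    (Finset.sum_map Finset.univ (Fin.castLEEmb hr) F)
  ext i
  simp only [firstIndices, Finset.mem_filter, Finset.mem_univ, true_and, Finset.mem_map,
    Nat.cast_lt]
  exact ⟨fun h => ⟨⟨i, h⟩, rfl⟩, by rintro ⟨j, rfl⟩; exact j.2⟩

variable {X : Type*} [TopologicalSpace X] [MeasurableSpace X] {m : Measure X}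
  (E : DirichletForm m) {ν : Measure X} {p : X → ℕ∞} {n : ℕ} {g : Fin n → E.domain}
  {f h : E.domain} {d d' : X → Fin n → ℝ}

lemma dotProduct_gram_mulVec {ι : Type*} [Fintype ι] (F : ι → E.domain) (v : ι → ℝ) (x : X) :
    v ⬝ᵥ (E.gram ν F x).mulVec v = ∑ i, ∑ j, v i * v j * E.density ν (F i) (F j) x := by
  simp only [dotProduct, Matrix.mulVec, gram, Matrix.of_apply, Finset.mul_sum]
  refine Finset.sum_congr rfl fun i _ => Finset.sum_congr rfl fun j _ => ?_
  ring

/-- The coefficients of the remainder form a null vector of the matrix of densities. -/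
lemma gram_mulVec_eq_zero {x : X}
    (hpsd : (E.gram ν (Fin.cons f g : Fin (n + 1) → E.domain) x).PosSemidef)
    (h0 : ∀ i : Fin n, p x ≤ ((i : ℕ) : ℕ∞) → d x i = 0)
    (hneg : E.remainderDensity ν p g f d x x = 0) :
    (E.gram ν (Fin.cons f g : Fin (n + 1) → E.domain) x).mulVec (Fin.cons 1 fun i => -d x i)
      = 0 := by
  -- An isotropic vector of a positive semidefinite matrix is a null vector.
  rw [← hpsd.dotProduct_mulVec_zero_iff, star_trivial, dotProduct_gram_mulVec, ← hneg,
    remainderDensity_eq_sum, remainderCoeff_of_eq_zero h0]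

/-- The normal equations for a gradient. -/
lemma density_eq_sum_of_gram_mulVec {x : X}
    (h0 : (E.gram ν (Fin.cons f g : Fin (n + 1) → E.domain) x).mulVec
      (Fin.cons 1 fun i => -d x i) = 0) (i : Fin n) :
    E.density ν (g i) f x = ∑ j, d x j * E.density ν (g i) (g j) x := by
  have := congrFun h0 i.succ
  simp only [Matrix.mulVec, dotProduct, Fin.sum_univ_succ, gram, Matrix.of_apply, Fin.cons_zero,
    Fin.cons_succ, Pi.zero_apply, mul_neg, mul_one, Finset.sum_neg_distrib] at this
  rw [← sub_eq_add_neg, sub_eq_zero] at this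
  rw [this]
  exact Finset.sum_congr rfl fun j _ => mul_comm _ _

variable [SecondCountableTopology X]
  [LocallyCompactSpace X] [TopologicalSpace.MetrizableSpace X] [BorelSpace X] [m.Regular]

lemma IsGradient.ae_gram_mulVec_eq_zero (hreg : E.IsRegular) (hν : E.IsMinimalEnergyDominant ν)
    (hd : E.IsGradient ν p g f d) :
    ∀ᵐ x ∂ν, (E.gram ν (Fin.cons f g : Fin (n + 1) → E.domain) x).mulVec
      (Fin.cons 1 fun i => -d x i) = 0 := by
  filter_upwards [E.posSemidef_gram hreg hν (Fin.cons f g : Fin (n + 1) → E.domain), hd.eq_zero,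
    hd.negligible] with x h1 h2 h3
  exact E.gram_mulVec_eq_zero h1 h2 h3

/-- Two gradients solve the same normal equations and vanish beyond the first `p(x)` coordinates, so
their difference lies in the kernel of the invertible block. -/
lemma IsGradient.ae_eq (hreg : E.IsRegular) (hν : E.IsMinimalEnergyDominant ν)
    (hg : E.IsCoordinateSystem ν p g) (hd : E.IsGradient ν p g f d)
    (hd' : E.IsGradient ν p g f d') : d =ᵐ[ν] d' := by
  filter_upwards [hd.ae_gram_mulVec_eq_zero E hreg hν, hd'.ae_gram_mulVec_eq_zero E hreg hν,
    hd.eq_zero, hd'.eq_zero, hg] with x h1 h2 h3 h4 h5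
  obtain ⟨r, hr, hpx, hZ⟩ := h5
  have hn : ∀ i : Fin n, ¬ ((i : ℕ) < r) → d x i = 0 ∧ d' x i = 0 := fun i hi => by
    have : p x ≤ ((i : ℕ) : ℕ∞) := by rw [hpx]; exact_mod_cast not_lt.1 hi
    exact ⟨h3 i this, h4 i this⟩
  have hsum : ∀ F : Fin n → ℝ, (∀ i : Fin n, ¬ ((i : ℕ) < r) → F i = 0) →
      ∑ i, F i = ∑ j : Fin r, F (Fin.castLE hr j) := fun F hF => by
    rw [← sum_firstIndices hr]
    refine (Finset.sum_subset (Finset.subset_univ _) fun i _ hi => hF i fun hlt => hi ?_).symm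
    simpa [firstIndices] using hlt
  have hker : (E.gram ν (fun i : Fin r => g (Fin.castLE hr i)) x).mulVec
      (fun j => d x (Fin.castLE hr j) - d' x (Fin.castLE hr j)) = 0 := by
    funext i
    have e1 := E.density_eq_sum_of_gram_mulVec h1 (Fin.castLE hr i)
    have e2 := E.density_eq_sum_of_gram_mulVec h2 (Fin.castLE hr i)
    rw [hsum _ fun i hi => by rw [(hn i hi).1, zero_mul]] at e1
    rw [hsum _ fun i hi => by rw [(hn i hi).2, zero_mul]] at e2
    simp only [Matrix.mulVec, dotProduct, gram, Matrix.of_apply, mul_sub, Finset.sum_sub_distrib,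
      Pi.zero_apply]
    rw [sub_eq_zero]
    simp only [mul_comm (E.density ν _ _ x)]
    rw [← e1, ← e2]
  have hz := Matrix.eq_zero_of_mulVec_eq_zero
    ((Matrix.isUnit_iff_isUnit_det _).1 hZ).ne_zero hker
  funext i
  by_cases hi : (i : ℕ) < r
  · exact sub_eq_zero.1 (congrFun hz ⟨i, hi⟩)
  · rw [(hn i hi).1, (hn i hi).2]

/-- In the Gram matrix of `(f, h, g)` the vector `(1, 0, -∇f)` is isotropic, hence null. Its `h`-row
expresses `dμ_⟨h,f⟩/dν` through the `dμ_⟨h,g_j⟩/dν`, and the normal equations for `h` turn these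
into `Z ∇h`. -/
lemma IsGradient.density_eq (hreg : E.IsRegular) (hν : E.IsMinimalEnergyDominant ν)
    {df dh : X → Fin n → ℝ} (hf : E.IsGradient ν p g f df) (hh : E.IsGradient ν p g h dh) :
    ∀ᵐ x ∂ν, E.density ν f h x = (E.gram ν g x).mulVec (df x) ⬝ᵥ dh x := by
  filter_upwards [E.posSemidef_gram hreg hν
      (Fin.cons f (Fin.cons h g : Fin (n + 1) → E.domain) : Fin (n + 2) → E.domain),
    hf.ae_gram_mulVec_eq_zero E hreg hν, hh.ae_gram_mulVec_eq_zero E hreg hν,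
    hf.eq_zero, hf.negligible] with x hpsd h1 h2 h3 h4
  set v : Fin (n + 2) → ℝ := Fin.cons 1 (Fin.cons 0 fun i => -df x i) with hv
  have hnull : (E.gram ν (Fin.cons f (Fin.cons h g : Fin (n + 1) → E.domain) :
      Fin (n + 2) → E.domain) x).mulVec v = 0 := by
    rw [← hpsd.dotProduct_mulVec_zero_iff, star_trivial, dotProduct_gram_mulVec, ← h4,
      remainderDensity_eq_sum, remainderCoeff_of_eq_zero h3]
    simp [hv, Fin.sum_univ_succ]
  have e1 : E.density ν h f x = ∑ j, df x j * E.density ν h (g j) x := by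
    have := congrFun hnull 1
    rw [← Fin.succ_zero_eq_one] at this
    simp only [Matrix.mulVec, dotProduct, Fin.sum_univ_succ, gram, Matrix.of_apply, Fin.cons_zero,
      Fin.cons_succ, Pi.zero_apply, mul_neg, mul_one, Finset.sum_neg_distrib, hv, mul_zero,
      zero_add] at this
    rw [← sub_eq_add_neg, sub_eq_zero] at this
    rw [this]
    exact Finset.sum_congr rfl fun j _ => mul_comm _ _
  rw [E.density_comm, e1]
  simp only [dotProduct, Matrix.mulVec, gram, Matrix.of_apply, Finset.sum_mul]
  rw [Finset.sum_comm]
  refine Finset.sum_congr rfl fun j _ => ?_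
  rw [E.density_comm, E.density_eq_sum_of_gram_mulVec h2 j, Finset.mul_sum]
  refine Finset.sum_congr rfl fun i _ => ?_
  rw [E.density_comm]; ring

end Pointwise

/-! ### Construction of the gradient. -/

section Existence

variable {X : Type*} [TopologicalSpace X] [MeasurableSpace X] {m : Measure X}
  (E : DirichletForm m) {ν : Measure X} {p : X → ℕ∞} {n : ℕ} {g : Fin n → E.domain}

/-- Solution of the normal equations for the first `r` coordinates, extended by zero. -/
noncomputable def gradientCoeff (ν : Measure X) (g : Fin n → E.domain) (f : E.domain) (r : ℕ)
    (hr : r ≤ n) (x : X) (i : Fin n) : ℝ :=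
  if hi : (i : ℕ) < r then ((E.gram ν (fun i : Fin r => g (Fin.castLE hr i)) x)⁻¹.mulVec
    fun j => E.density ν (g (Fin.castLE hr j)) f x) ⟨i, hi⟩ else 0

lemma measurable_gradientCoeff (f : E.domain) (r : ℕ) (hr : r ≤ n) (i : Fin n) :
    Measurable fun x => E.gradientCoeff ν g f r hr x i := by
  unfold gradientCoeff
  split_ifs with hi
  · simp only [Matrix.mulVec, dotProduct]
    refine Finset.measurable_sum _ fun j _ => Measurable.mul ?_ (E.measurable_density _ _)
    have hA : Measurable fun x => fun i j : Fin r =>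
        E.density ν (g (Fin.castLE hr i)) (g (Fin.castLE hr j)) x :=
      measurable_pi_lambda _ fun i => measurable_pi_lambda _ fun j => E.measurable_density _ _
    have hdet : Continuous fun A : Fin r → Fin r → ℝ => (Matrix.of A).det :=
      Continuous.matrix_det (continuous_id : Continuous fun A : Matrix (Fin r) (Fin r) ℝ => A)
    have hadj : Continuous fun A : Fin r → Fin r → ℝ => (Matrix.of A).adjugate ⟨i, hi⟩ j :=
      Continuous.matrix_elem
        (Continuous.matrix_adjugate (continuous_id : Continuous fun A : Matrix (Fin r) (Fin r) ℝ => A))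
        _ _
    -- The inverse is the adjugate times the inverse of the determinant, with value zero where the
    -- matrix is singular; this formula is measurable everywhere.
    simp only [Matrix.inv_def, Matrix.smul_apply, smul_eq_mul, Ring.inverse_eq_inv']
    exact (hdet.measurable.comp hA).inv.mul (hadj.measurable.comp hA)
  · exact measurable_const

/-- The rank bound makes the Gram matrix of `f` and the first `r` coordinates singular over an
invertible corner, so `(1, -d)` is a null vector of it. -/
lemma remainderDensity_gradientCoeff {f : E.domain} {r : ℕ} (hr : r ≤ n) {x : X}
    {d : X → Fin n → ℝ} (hpx : p x = r) (hd : d x = E.gradientCoeff ν g f r hr x)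
    (hrank : (E.gram ν (Fin.cons f fun i => g (Fin.castLE hr i) : Fin (r + 1) → E.domain) x).rank
      ≤ r)
    (hZ : IsUnit (E.gram ν (fun i : Fin r => g (Fin.castLE hr i)) x)) :
    E.remainderDensity ν p g f d x x = 0 := by
  have h1 := Matrix.eq_zero_of_bordered_rank_le _ hrank hZ
  set c : Fin r → ℝ := fun j => d x (Fin.castLE hr j) with hc
  have hcv : ∀ j : Fin r, ((E.gram ν (fun i : Fin r => g (Fin.castLE hr i)) x)⁻¹.mulVec
      fun j => E.density ν (g (Fin.castLE hr j)) f x) j = c j := fun j => by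
    rw [hc]
    simp only [hd, gradientCoeff, Fin.val_castLE, Fin.is_lt, dif_pos, Fin.eta]
  have h2 : (E.gram ν (Fin.cons f fun i => g (Fin.castLE hr i) : Fin (r + 1) → E.domain) x).mulVec
      (Fin.cons 1 fun i => -c i) = 0 := by
    rw [← h1]
    congr 1
    congr 1
    funext j
    rw [← hcv]
    rfl
  have h3 : (Fin.cons 1 fun i => -c i : Fin (r + 1) → ℝ) ⬝ᵥ
      (E.gram ν (Fin.cons f fun i => g (Fin.castLE hr i) : Fin (r + 1) → E.domain) x).mulVec
      (Fin.cons 1 fun i => -c i) = 0 := by rw [h2, dotProduct_zero]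
  have h4 : remainderCoeff r (p x) c = (Fin.cons 1 fun i => -c i : Fin (r + 1) → ℝ) := by
    refine remainderCoeff_of_eq_zero fun i hi => ?_
    rw [hpx] at hi
    exact absurd (by exact_mod_cast hi : r ≤ (i : ℕ)) (not_le.2 i.2)
  rw [dotProduct_gram_mulVec, ← h4] at h3
  have h5 := E.remainderDensity_eq_sum (ν := ν) (p := p) (f := f)
    (g := fun i : Fin r => g (Fin.castLE hr i)) (fun _ => c) x x
  rw [h3] at h5
  rw [← h5]
  have hself : ∀ F : Fin r → ℝ, ∑ i ∈ firstIndices r (p x), F i = ∑ i, F i := fun F => by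
    rw [hpx, sum_firstIndices le_rfl]; rfl
  simp only [remainderDensity, hself]
  simp only [hpx, sum_firstIndices hr]
  rfl

variable [SecondCountableTopology X]
  [LocallyCompactSpace X] [TopologicalSpace.MetrizableSpace X] [BorelSpace X] [m.Regular]

lemma exists_isGradient (hreg : E.IsRegular) (hloc : E.IsStronglyLocal)
    (hν : E.IsMinimalEnergyDominant ν) (hp : E.IsPointwiseIndex ν p)
    (hg : E.IsCoordinateSystem ν p g) (f : E.domain) :
    ∃ d : X → Fin n → ℝ, E.IsGradient ν p g f d := by
  -- Working with a measurable version of the index makes its level sets measurable, and the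
  -- gradient is pieced together from the solutions on `{p' = r}`, `r ≤ n`.
  set p' := hp.aemeasurable.mk p with hp'
  set d : X → Fin n → ℝ := fun x => if h : ∃ r : Fin (n + 1), p' x = (r : ℕ) then
    E.gradientCoeff ν g f h.choose (Nat.lt_succ_iff.1 h.choose.2) x else 0 with hd
  have hdr : ∀ (x : X) (r : ℕ) (hr : r ≤ n), p' x = r → d x = E.gradientCoeff ν g f r hr x := by
    intro x r hr hx
    have h : ∃ r : Fin (n + 1), p' x = (r : ℕ) := ⟨⟨r, Nat.lt_succ_iff.2 hr⟩, hx⟩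
    have h1 : (h.choose : ℕ) = r := by
      have := h.choose_spec.symm.trans hx
      exact_mod_cast this
    rw [hd]
    simp only [dif_pos h]
    congr 1
  have hdm : Measurable d := by
    have hsum : d = fun x i => ∑ r : Fin (n + 1), (p' ⁻¹' {((r : ℕ) : ℕ∞)}).indicator
        (fun x => E.gradientCoeff ν g f r (Nat.lt_succ_iff.1 r.2) x i) x := by
      funext x i
      by_cases h : ∃ r : Fin (n + 1), p' x = (r : ℕ)
      · obtain ⟨r, hr⟩ := h
        rw [hdr x r (Nat.lt_succ_iff.1 r.2) hr, Finset.sum_eq_single r]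
        · rw [Set.indicator_of_mem (by exact hr)]
        · intro s _ hs
          refine Set.indicator_of_notMem (fun hmem => hs ?_) _
          have : p' x = (s : ℕ) := hmem
          rw [hr] at this
          exact Fin.ext (by exact_mod_cast this.symm)
        · intro hh; exact absurd (Finset.mem_univ _) hh
      · rw [hd]
        simp only [dif_neg h, Pi.zero_apply]
        refine (Finset.sum_eq_zero fun r _ => ?_).symm
        have hmem : x ∉ p' ⁻¹' {((r : ℕ) : ℕ∞)} := fun hmem => h ⟨r, hmem⟩
        exact Set.indicator_of_notMem hmem _
    rw [hsum]
    refine measurable_pi_lambda _ fun i => Finset.measurable_sum _ fun r _ => ?_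
    exact (E.measurable_gradientCoeff f r _ i).indicator
      (hp.aemeasurable.measurable_mk (measurableSet_singleton _))
  refine ⟨d, hdm.aemeasurable, ?_, fun ft gt hft hgt =>
    E.expansion_of_coeff hreg hloc hν d ft gt hft.1 fun i => (hgt i).1, ?_⟩
  · filter_upwards [hg, hp.aemeasurable.ae_eq_mk] with x h1 h2 i hi
    obtain ⟨r, hr, hpx, -⟩ := h1
    rw [hdr x r hr (h2.symm.trans hpx), gradientCoeff, dif_neg]
    rw [hpx] at hi
    exact not_lt.2 (by exact_mod_cast hi)
  -- The size of the block depends on `x`, but only `n + 1` sizes occur, so the rank bound holds for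
  -- all of them off one null set.
  · have hrank : ∀ᵐ x ∂ν, ∀ r : Fin (n + 1), ((E.gram ν (Fin.cons f fun i =>
        g (Fin.castLE (Nat.lt_succ_iff.1 r.2) i) : Fin (r + 1) → E.domain) x).rank : ℕ∞) ≤ p x :=
      ae_all_iff.2 fun r => hp.boundsRank _ _
    filter_upwards [hg, hp.aemeasurable.ae_eq_mk, hrank] with x h1 h2 h3
    obtain ⟨r, hr, hpx, hZ⟩ := h1
    refine E.remainderDensity_gradientCoeff hr hpx (hdr x r hr (h2.symm.trans hpx)) ?_ hZ
    have := h3 ⟨r, Nat.lt_succ_iff.2 hr⟩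
    rw [hpx] at this
    exact_mod_cast this

end Existence

end DirichletForm

theorem mainTheorem2 {X : Type*} [TopologicalSpace X] [LocallyCompactSpace X]
    [TopologicalSpace.SeparableSpace X] [TopologicalSpace.MetrizableSpace X]
    [MeasurableSpace X] [BorelSpace X]
    (m : Measure X) [m.Regular] [m.IsOpenPosMeasure]
    (E : DirichletForm m) (hreg : E.IsRegular) (hloc : E.IsStronglyLocal)
    (ν : Measure X) (hν : E.IsMinimalEnergyDominant ν)
    (p : X → ℕ∞) (hp : E.IsPointwiseIndex ν p)
    (n : ℕ) (hn : 0 < n) (hindex : essSup p ν = n)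
    (g : Fin n → E.domain) (hg : E.IsCoordinateSystem ν p g) :
    (∀ f : E.domain, ∃ d : X → Fin n → ℝ, E.IsGradient ν p g f d) ∧
    (∀ (f : E.domain) (d d' : X → Fin n → ℝ),
      E.IsGradient ν p g f d → E.IsGradient ν p g f d' → d =ᵐ[ν] d') ∧
    (∀ (f h : E.domain) (df dh : X → Fin n → ℝ),
      E.IsGradient ν p g f df → E.IsGradient ν p g h dh →
        Integrable (fun x => (E.gram ν g x).mulVec (df x) ⬝ᵥ dh x) ν ∧
        E.form f h = 1 / 2 * ∫ x, (E.gram ν g x).mulVec (df x) ⬝ᵥ dh x ∂ν) := by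
  have : SecondCountableTopology X := by
    let := TopologicalSpace.metrizableSpaceMetric X
    exact UniformSpace.secondCountable_of_separable X
  refine ⟨fun f => E.exists_isGradient hreg hloc hν hp hg f,
    fun f d d' hd hd' => hd.ae_eq E hreg hν hg hd', fun f h df dh hf hh => ?_⟩
  have hae := hf.density_eq E hreg hν hh
  refine ⟨(E.integrable_density f h).congr hae, ?_⟩
  rw [← integral_congr_ae hae, E.integral_density hreg hloc hν]
  ring
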